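/- For $0<q<1$ write $(a;q)_n=\prod_{i=0}^{n-1}(1-aq^i)$, $(a;q)_\infty=\prod_{i\ge0}(1-aq^i)$ and $(a_1,\dots,a_k;q)_\infty=\prod_{r=1}^{k}(a_r;q)_\infty$. The Jackson $q$-integral is $\int_0^\alpha f(x)\,d_qx=(1-q)\sum_{k\ge0}\alpha q^k f(\alpha q^k)$ and $\int_a^b f\,d_qx=\int_0^b f\,d_qx-\int_0^a f\,d_qx$. Let $$\omega(x)=\frac{(qx,-qx;q)_\infty}{(q,-1,-q;q)_\infty},\qquad H_n(x;q)=\sum_{0\le k\le n/2}(-1)^k\frac{(q^{-n};q^2)_k\,(q^{-n+1};q^2)_k\,q^{k(2n-k)}}{(q^2;q^2)_k}\,x^{n-2k}$$ be the discrete $q$-Hermite weight and polynomials, let $$\rho_N(x)=\frac1{1-q}\sum_{j=0}^{N-1}\frac{H_j(x;q)^2}{(q;q)_j\,q^{j(j-1)/2}}\,\omega(x),\qquad \widehat\rho_N(x)=\sqrt{1-q}\,\rho_N(\sqrt{1-q}\,x)$$ be the density of the discrete $q$-deformed GUE and its rescaling, and let $$m^{(dH)}_{N,2p}=\int_{-1}^1|x|^{2p}\rho_N(x)\,d_qx,\qquad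 \widehat m^{(dH)}_{N,2p}=\int_{-1/\sqrt{1-q}}^{1/\sqrt{1-q}}|x|^{2p}\,\widehat\rho_N(x)\,d_qx$$ be the spectral moments. Let $I_x(a,b)=\frac{\Gamma(a+b)}{\Gamma(a)\Gamma(b)}\int_0^x t^{a-1}(1-t)^{b-1}\,dt$ be the regularised incomplete beta function. Theorem 2.2. Fix $\lambda>0$ and a positive integer $p$, and for each $N\ge1$ take $q=e^{-\lambda/N}$. Then for every $N\ge 1$ the series defining $m^{(dH)}_{N,2p}$ and $\widehat m^{(dH)}_{N,2p}$ converge and $q^p m^{(dH)}_{N,2p}=\big(q(1-q)\big)^p\,\widehat m^{(dH)}_{N,2p}$, and as $N\to\infty$ $$q^p m^{(dH)}_{N,2p}=\mathcal M_{2p,0}\,N+\frac{\mathcal M_{2p,1}}{N}+O\Big(\frac1{N^3}\Big),$$ where $$\mathcal M_{2p,0}=\frac1{\lambda p}\,I_{1-e^{-\lambda}}(p+1,p),$$ $$\mathcal M_{2p,1}=-\frac{\lambda p}{6}\bigg(I_{1-e^{-\lambda}}(p+1,p)+\frac{(2p-1)!}{p!\,(p-1)!}\,e^{-p\lambda}(1-e^{-\lambda})^{p-1}\Big(2+p-(2p+1)e^{-\lambda}\Big)\bigg).$$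 -/

import Mathlib

open Filter Asymptotics

noncomputable section

namespace DiscreteQGUE

/-- The finite `q`-shifted factorial `(a;q)_n = (1-a)(1-aq)⋯(1-aq^{n-1})`. -/
def qPoch (a q : ℝ) (n : ℕ) : ℝ :=
  ∏ i ∈ Finset.range n, (1 - a * q ^ i)

/-- The infinite `q`-shifted factorial `(a;q)_∞ = ∏_{l ≥ 0} (1 - a q^l)`. -/
def qPochInf (a q : ℝ) : ℝ :=
  ∏' l : ℕ, (1 - a * q ^ l)

/-- The product defining `(a;q)_∞` converges for `|q| < 1`. -/
theorem multipliable_qPochInf (a q : ℝ) (hq : |q| < 1) :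
    Multipliable fun l : ℕ => 1 - a * q ^ l := by
  have h : Summable fun l : ℕ => ‖-(a * q ^ l)‖ := by
    simpa [abs_mul] using (summable_geometric_of_abs_lt_one (r := |q|) (by simpa using hq)).mul_left |a|
  simpa [sub_eq_add_neg] using multipliable_one_add_of_summable h

/-- The Jackson `q`-integral `∫_0^α f(x) d_q x = (1-q) ∑_{k ≥ 0} α q^k f(α q^k)`. -/
def jacksonFromZero (q α : ℝ) (f : ℝ → ℝ) : ℝ :=
  (1 - q) * ∑' k : ℕ, α * q ^ k * f (α * q ^ k)

/-- The Jackson `q`-integral `∫_a^b f(x) d_q x = ∫_0^b f(x) d_q x - ∫_0^a f(x) d_q x`. -/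
def jacksonIntegral (q a b : ℝ) (f : ℝ → ℝ) : ℝ :=
  jacksonFromZero q b f - jacksonFromZero q a f

/-- Both series that define `∫_a^b f(x) d_q x` converge. -/
def JacksonIntegrable (q a b : ℝ) (f : ℝ → ℝ) : Prop :=
  (Summable fun k : ℕ => b * q ^ k * f (b * q ^ k)) ∧
    Summable fun k : ℕ => a * q ^ k * f (a * q ^ k)

/-- The discrete `q`-Hermite weight `ω(x) = (qx, -qx; q)_∞ / (q, -1, -q; q)_∞`. -/
def weight (q x : ℝ) : ℝ :=
  (qPochInf (q * x) q * qPochInf (-(q * x)) q) /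
    (qPochInf q q * qPochInf (-1) q * qPochInf (-q) q)

/-- The (monic) discrete `q`-Hermite polynomial
`H_n(x;q) = ∑_{0 ≤ k ≤ n/2} (-1)^k (q^{-n};q^2)_k (q^{-n+1};q^2)_k q^{k(2n-k)} / (q^2;q^2)_k x^{n-2k}`.
The natural-number subtractions are exact since `2k ≤ n`. -/
def hermite (n : ℕ) (q x : ℝ) : ℝ :=
  ∑ k ∈ Finset.range (n / 2 + 1),
    (-1) ^ k *
      (qPoch (q ^ (-(n : ℤ))) (q ^ 2) k * qPoch (q ^ (-(n : ℤ) + 1)) (q ^ 2) k *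
          q ^ (k * (2 * n - k)) / qPoch (q ^ 2) (q ^ 2) k) *
      x ^ (n - 2 * k)

/-- The density of the discrete `q`-GUE,
`ρ_N(x) = (1-q)^{-1} ∑_{j < N} H_j(x;q)^2 / ((q;q)_j q^{j(j-1)/2}) ω(x)`. -/
def density (N : ℕ) (q x : ℝ) : ℝ :=
  1 / (1 - q) *
    (∑ j ∈ Finset.range N, hermite j q x ^ 2 / (qPoch q q j * q ^ (j * (j - 1) / 2))) *
    weight q x

/-- The rescaled density `ρ̂_N(x) = √(1-q) ρ_N(√(1-q) x)`. -/
def densityHat (N : ℕ) (q x : ℝ) : ℝ :=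
  √(1 - q) * density N q (√(1 - q) * x)

/-- The spectral moment `m_{N,2p} = ∫_{-1}^1 |x|^{2p} ρ_N(x) d_q x`. -/
def moment (N p : ℕ) (q : ℝ) : ℝ :=
  jacksonIntegral q (-1) 1 fun x => |x| ^ (2 * p) * density N q x

/-- The rescaled spectral moment
`m̂_{N,2p} = ∫_{-1/√(1-q)}^{1/√(1-q)} |x|^{2p} ρ̂_N(x) d_q x`. -/
def momentHat (N p : ℕ) (q : ℝ) : ℝ :=
  jacksonIntegral q (-1 / √(1 - q)) (1 / √(1 - q)) fun x => |x| ^ (2 * p) * densityHat N q x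

/-- The regularised incomplete beta function
`I_x(a,b) = Γ(a+b) / (Γ(a) Γ(b)) ∫_0^x t^{a-1} (1-t)^{b-1} dt`. -/
def regIncBeta (x a b : ℝ) : ℝ :=
  Real.Gamma (a + b) / (Real.Gamma a * Real.Gamma b) *
    ∫ t in (0 : ℝ)..x, t ^ (a - 1) * (1 - t) ^ (b - 1)

/-- The scaling `q = e^{-λ/N}`. -/
def scaledQ (lam : ℝ) (N : ℕ) : ℝ :=
  Real.exp (-lam / N)

/-- The leading coefficient `ℳ_{2p,0}`. -/
def genusZeroCoeff (p : ℕ) (lam : ℝ) : ℝ :=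
  1 / (lam * p) * regIncBeta (1 - Real.exp (-lam)) (p + 1) p

/-- The first correction `ℳ_{2p,1}`. -/
def genusOneCoeff (p : ℕ) (lam : ℝ) : ℝ :=
  -(lam * p / 6) *
    (regIncBeta (1 - Real.exp (-lam)) (p + 1) p +
      ((2 * p - 1).factorial : ℝ) / ((p.factorial : ℝ) * ((p - 1).factorial : ℝ)) *
        Real.exp (-(p * lam)) * (1 - Real.exp (-lam)) ^ (p - 1) *
        (2 + p - (2 * p + 1) * Real.exp (-lam)))

end DiscreteQGUE

end

/-! The discrete q-Hermite polynomials are monic, orthogonal for the Jackson weight, and have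
recurrence coefficient q^(n-1)(1-q^n). The j-th summand of the moment is therefore a diagonal entry
of the 2p-th power of a Jacobi matrix: a sum over closed ±1 paths of 2p steps started at j, each of
the p down-steps carrying the coefficient at its height (`functional_pow_mul_hermite`). Paths that
go below 0 cost nothing, since the coefficient vanishes at 0, so the set of paths does not depend on
j.

Put q = e^{-θ} with θ = λ/N. Then q times the coefficient is e^{-θn} - e^{-2θn}. Multiply out the
product over the down-steps, with S the subset where the second exponential is taken; the sum over j
becomes a geometric series of ratio e^{-θA}, A = p + |S|. Heights are measured from j + 1/2, and
averaging a path with its reversal turns the remaining factor into cosh(θD)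
(`pow_mul_moment_eq_sum_cosh`). The moment is thus an exact signed sum, over an index set
independent of N, of (1 - e^{-λA}) cosh(θD) / (2 sinh(θA/2)). This is odd in θ once λ is held fixed,
whence the orders N, 1/N, 1/N³ (`sum_exp_mul_cosh_isBigO`).

The coefficients are compared with the beta integrals as functions of u = e^{-λ} by differentiation
(`path_sum_leading`, `path_sum_correction`). The derivative removes the denominators A and leaves
subset sums of 1, D² and A², which factor over the down-steps. The path averages then needed follow
from the exchangeability of the steps of a bridge (`sum_bridges_linear_sq`). -/

noncomputable section

namespace DiscreteQGUE

/-! ### Coefficients, three-term recurrence and shift relations of the polynomials. -/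

/-- The falling product `(1 - q^n)(1 - q^{n-1})⋯(1 - q^{n-m+1})`, which vanishes for `m > n`. -/
def qFalling (q : ℝ) (n m : ℕ) : ℝ :=
  ∏ i ∈ Finset.range m, (1 - q ^ (n - i))

theorem qFalling_succ (q : ℝ) (n m : ℕ) :
    qFalling q n (m + 1) = qFalling q n m * (1 - q ^ (n - m)) :=
  Finset.prod_range_succ _ _

theorem qFalling_succ_succ (q : ℝ) (n m : ℕ) :
    qFalling q (n + 1) (m + 1) = (1 - q ^ (n + 1)) * qFalling q n m := by
  simp [qFalling, Finset.prod_range_succ', mul_comm]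

theorem qFalling_eq_zero (q : ℝ) {n m : ℕ} (h : n < m) : qFalling q n m = 0 :=
  Finset.prod_eq_zero (Finset.mem_range.2 h) (by simp)

theorem qPoch_succ (a q : ℝ) (n : ℕ) : qPoch a q (n + 1) = qPoch a q n * (1 - a * q ^ n) :=
  Finset.prod_range_succ _ _

theorem qPoch_pos {a q : ℝ} (ha : a < 1) (hq0 : 0 ≤ q) (hq1 : q ≤ 1) (n : ℕ) :
    0 < qPoch a q n := by
  refine Finset.prod_pos fun i _ => ?_
  have h0 : 0 ≤ q ^ i := pow_nonneg hq0 i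
  have h1 : q ^ i ≤ 1 := pow_le_one₀ hq0 hq1
  rcases le_total a 0 with h | h <;> nlinarith

/-- The coefficient of `x^{n-2k}` in the discrete `q`-Hermite polynomial of degree `n`. -/
def hermiteCoeff (q : ℝ) (n k : ℕ) : ℝ :=
  (-1) ^ k * (q ^ (k * (k - 1)) * qFalling q n (2 * k) / qPoch (q ^ 2) (q ^ 2) k)

/-- The recurrence coefficient `q^{n-1}(1-q^n)`. -/
def recCoeff (q : ℝ) (n : ℕ) : ℝ := q ^ (n - 1) * (1 - q ^ n)

theorem recCoeff_zero (q : ℝ) : recCoeff q 0 = 0 := by simp [recCoeff]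

/-- Each factor 1 - q^(-a) equals -q^(-a)(1 - q^a); the factors come in pairs, so the signs cancel
and the power of q absorbs the negative exponents. -/
theorem qPoch_mul_qPoch_eq_qFalling {q : ℝ} (hq : q ≠ 0) (n k : ℕ) (h : 2 * k ≤ n) :
    qPoch (q ^ (-(n : ℤ))) (q ^ 2) k * qPoch (q ^ (-(n : ℤ) + 1)) (q ^ 2) k *
      q ^ (k * (2 * n - k)) = q ^ (k * (k - 1)) * qFalling q n (2 * k) := by
  induction k with
  | zero => simp [qPoch, qFalling]
  | succ k ih =>
    obtain ⟨e, rfl⟩ := Nat.exists_eq_add_of_le h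
    specialize ih (by omega)
    set n := 2 * (k + 1) + e with hn
    have e1 : (k + 1) * (2 * n - (k + 1)) = k * (2 * n - k) + (2 * k + 2 * e + 3) := by
      have h1 : 2 * n - (k + 1) = 3 * k + 2 * e + 3 := by omega
      have h2 : 2 * n - k = 3 * k + 2 * e + 4 := by omega
      rw [h1, h2]; ring
    have e2 : (k + 1) * (k + 1 - 1) = k * (k - 1) + 2 * k := by
      cases k with
      | zero => simp
      | succ k => simp; ring
    rw [qPoch_succ, qPoch_succ, e1, e2, show 2 * (k + 1) = 2 * k + 1 + 1 by ring, qFalling_succ,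
      qFalling_succ, show n - (2 * k + 1) = e + 1 by omega, show n - 2 * k = e + 2 by omega,
      pow_add, pow_add]
    have h3 : q ^ (-(n : ℤ)) * (q ^ 2) ^ k * q ^ (e + 2) = 1 := by
      rw [zpow_neg, zpow_natCast, mul_assoc, ← pow_mul, ← pow_add,
        show 2 * k + (e + 2) = n by omega, inv_mul_cancel₀ (pow_ne_zero _ hq)]
    have h4 : q ^ (-(n : ℤ) + 1) * (q ^ 2) ^ k * q ^ (e + 1) = 1 := by
      rw [zpow_add₀ hq, zpow_one, ← h3]; ring
    have h5 : (1 - q ^ (-(n : ℤ)) * (q ^ 2) ^ k) * (1 - q ^ (-(n : ℤ) + 1) * (q ^ 2) ^ k) *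
        q ^ (2 * k + 2 * e + 3) = q ^ (2 * k) * ((1 - q ^ (e + 2)) * (1 - q ^ (e + 1))) := by
      rw [show 2 * k + 2 * e + 3 = 2 * k + ((e + 2) + (e + 1)) by ring, pow_add q (2 * k),
        pow_add q (e + 2)]
      linear_combination (-(q ^ (2 * k)) * q ^ (e + 1)) * h3 + (-(q ^ (2 * k)) * q ^ (e + 2)) * h4
        + q ^ (2 * k) * (q ^ (-(n : ℤ) + 1) * (q ^ 2) ^ k * q ^ (e + 1)) * h3 +
          q ^ (2 * k) * h4
    linear_combination (q ^ (2 * k) * ((1 - q ^ (e + 2)) * (1 - q ^ (e + 1)))) * ih +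
      (qPoch (q ^ (-(n : ℤ))) (q ^ 2) k * qPoch (q ^ (-(n : ℤ) + 1)) (q ^ 2) k *
      q ^ (k * (2 * n - k))) * h5

theorem hermiteCoeff_eq_zero (q : ℝ) {n k : ℕ} (h : n < 2 * k) : hermiteCoeff q n k = 0 := by
  simp [hermiteCoeff, qFalling_eq_zero q h]

theorem hermite_eq_sum {q : ℝ} (hq : q ≠ 0) (n K : ℕ) (hK : n / 2 + 1 ≤ K) (x : ℝ) :
    hermite n q x = ∑ k ∈ Finset.range K, hermiteCoeff q n k * x ^ (n - 2 * k) := by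
  have hsub : Finset.range (n / 2 + 1) ⊆ Finset.range K := by simpa using hK
  rw [← Finset.sum_subset hsub]
  · refine Finset.sum_congr rfl fun k hk => ?_
    rw [Finset.mem_range] at hk
    rw [hermiteCoeff, qPoch_mul_qPoch_eq_qFalling hq n k (by omega)]
  · intro k _ hk
    rw [Finset.mem_range] at hk
    rw [hermiteCoeff_eq_zero q (by omega), zero_mul]

theorem hermiteCoeff_zero (q : ℝ) (n : ℕ) : hermiteCoeff q n 0 = 1 := by
  simp [hermiteCoeff, qFalling, qPoch]

theorem hermiteCoeff_recurrence {q : ℝ} (hq0 : 0 < q) (hq1 : q < 1) (n k : ℕ)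
    (h : 2 * k ≤ n) :
    hermiteCoeff q (n + 1) (k + 1) =
      hermiteCoeff q (n + 1 + 1) (k + 1) + recCoeff q (n + 1) * hermiteCoeff q n k := by
  obtain ⟨e, rfl⟩ := Nat.exists_eq_add_of_le h
  have hp : ∀ m, qPoch (q ^ 2) (q ^ 2) m ≠ 0 := fun m =>
    (qPoch_pos (by nlinarith) (by positivity) (by nlinarith) m).ne'
  have hne := hp (k + 1)
  have hne' := hp k
  have e2 : (k + 1) * (k + 1 - 1) = k * (k - 1) + 2 * k := by
    cases k with
    | zero => simp
    | succ k => simp; ring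
  rw [hermiteCoeff, hermiteCoeff, hermiteCoeff, recCoeff, e2, show 2 * (k + 1) = 2 * k + 1 + 1 by ring,
    qFalling_succ_succ, qFalling_succ_succ q (2 * k + e + 1), qFalling_succ_succ, qFalling_succ,
    show 2 * k + e + 1 - 1 = 2 * k + e by omega, show 2 * k + e - 2 * k = e by omega, qPoch_succ]
  rw [qPoch_succ] at hne
  have hd := right_ne_zero_of_mul hne
  rw [show q ^ 2 * (q ^ 2) ^ k = q ^ (2 * k) * q ^ 2 by ring] at hd ⊢
  generalize hT : q ^ (2 * k) = T at hd
  rw [show q ^ (2 * k + e) = T * q ^ e by rw [pow_add, hT],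
    show q ^ (2 * k + e + 1) = T * q ^ e * q by rw [pow_add, pow_add, hT, pow_one],
    show q ^ (2 * k + e + 1 + 1) = T * q ^ e * q * q by
      rw [pow_add, pow_add, pow_add, hT, pow_one], pow_add q, hT, pow_succ (-1 : ℝ)]
  field_simp
  ring

/-- The three-term recurrence. -/
theorem mul_hermite {q : ℝ} (hq0 : 0 < q) (hq1 : q < 1) (n : ℕ) (x : ℝ) :
    x * hermite n q x = hermite (n + 1) q x + recCoeff q n * hermite (n - 1) q x := by
  have hq := hq0.ne'
  cases n with
  | zero => simp [recCoeff_zero, hermite, qPoch]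
  | succ n =>
    rw [hermite_eq_sum hq (n + 1) (n + 2) (by omega), hermite_eq_sum hq (n + 1 + 1) (n + 2) (by omega),
      hermite_eq_sum hq (n + 1 - 1) (n + 1) (by omega), Finset.sum_range_succ' _ (n + 1),
      Finset.sum_range_succ' _ (n + 1), mul_add, Finset.mul_sum, Finset.mul_sum,
      add_right_comm, ← Finset.sum_add_distrib]
    congr 1
    · refine Finset.sum_congr rfl fun k _ => ?_
      rw [Nat.add_sub_cancel]
      by_cases h : 2 * k ≤ n
      · rw [hermiteCoeff_recurrence hq0 hq1 n k h, show n + 1 + 1 - 2 * (k + 1) = n - 2 * k by omega]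
        -- Here `n + 1 - 2 * (k + 1)` truncates to 0 where -1 is meant; the coefficient attached to
        -- it vanishes, so the two remaining terms cancel.
        by_cases h' : 2 * k = n
        · have h0 := hermiteCoeff_recurrence hq0 hq1 n k h
          rw [hermiteCoeff_eq_zero q (show n + 1 < 2 * (k + 1) by omega)] at h0
          rw [← h0]
          linear_combination (x ^ (n - 2 * k)) * h0
        · rw [show n - 2 * k = n + 1 - 2 * (k + 1) + 1 by omega]
          ring
      · rw [hermiteCoeff_eq_zero q (show n + 1 < 2 * (k + 1) by omega),
          hermiteCoeff_eq_zero q (show n + 1 + 1 < 2 * (k + 1) by omega),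
          hermiteCoeff_eq_zero q (show n < 2 * k by omega)]
        ring
    · simp only [hermiteCoeff_zero]
      simp
      ring

theorem hermite_zero (q x : ℝ) : hermite 0 q x = 1 := by simp [hermite, qPoch]

theorem hermite_succ {q : ℝ} (hq0 : 0 < q) (hq1 : q < 1) (n : ℕ) (x : ℝ) :
    hermite (n + 1) q x = x * hermite n q x - recCoeff q n * hermite (n - 1) q x := by
  rw [mul_hermite hq0 hq1]; ring

@[fun_prop]
theorem continuous_hermite (n : ℕ) (q : ℝ) : Continuous (hermite n q) := by
  unfold hermite; fun_prop

/-- The forward shift relation. -/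
theorem hermite_sub_hermite_mul {q : ℝ} (hq0 : 0 < q) (hq1 : q < 1) (n : ℕ) (x : ℝ) :
    hermite n q x - hermite n q (q * x) = (1 - q ^ n) * x * hermite (n - 1) q x := by
  induction n using Nat.strong_induction_on with
  | _ n ih =>
    match n with
    | 0 => simp [hermite_zero]
    | 1 =>
      have h1 := fun x => hermite_succ hq0 hq1 0 x
      simp only [zero_add, recCoeff_zero, hermite_zero] at h1
      simp only [h1, Nat.sub_self, hermite_zero]; ring
    | m + 2 =>
      have i1 := ih (m + 1) (by omega)
      have i0 := ih m (by omega)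
      have r1 := hermite_succ hq0 hq1 (m + 1) x
      have r1' := hermite_succ hq0 hq1 (m + 1) (q * x)
      have r0 := hermite_succ hq0 hq1 m x
      simp only [Nat.add_sub_cancel, show m + 2 - 1 = m + 1 by omega] at *
      -- Compatibility of the recurrence coefficients with the shift: this is what lets the
      -- lowest-degree terms cancel.
      have hrel : recCoeff q (m + 1) * (1 - q ^ m) = q * (1 - q ^ (m + 1)) * recCoeff q m := by
        cases m with
        | zero => simp [recCoeff]
        | succ m => simp only [recCoeff, Nat.add_sub_cancel]; ring
      rw [show m + 2 = m + 1 + 1 from rfl, r1, r1']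
      linear_combination q * x * i1 - recCoeff q (m + 1) * i0 - x * hermite (m - 1) q x * hrel +
       (-q * (1 - q ^ (m + 1)) * x) * r0

/-- The backward shift relation. -/
theorem hermite_backward_shift {q : ℝ} (hq0 : 0 < q) (hq1 : q < 1) (n : ℕ) (x : ℝ) :
    q ^ n * (hermite n q x - (1 - x ^ 2) * hermite n q (x / q)) = x * hermite (n + 1) q x := by
  obtain ⟨y, rfl⟩ : ∃ y, x = q * y := ⟨x / q, by field_simp⟩
  rw [mul_div_cancel_left₀ _ hq0.ne']
  have f0 := hermite_sub_hermite_mul hq0 hq1 n y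
  have f1 := hermite_sub_hermite_mul hq0 hq1 (n + 1) y
  have r := hermite_succ hq0 hq1 n y
  have e : recCoeff q n * q = q ^ n * (1 - q ^ n) := by
    cases n with
    | zero => simp [recCoeff]
    | succ n => simp only [recCoeff, Nat.add_sub_cancel]; ring
  rw [Nat.add_sub_cancel] at f1
  linear_combination (-q ^ n) * f0 + q * y * f1 - q * y * r + y * hermite (n - 1) q y * e

/-! ### The weight on the lattice ±q^k. -/

theorem qPochInf_eq_mul {a q : ℝ} (hq : |q| < 1) :
    qPochInf a q = (1 - a) * qPochInf (q * a) q := by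
  unfold qPochInf
  rw [tprod_eq_zero_mul']
  · simp [pow_succ, mul_assoc, mul_comm]
  · have := multipliable_qPochInf (q * a) q hq
    refine this.congr fun l => ?_
    rw [pow_succ]; ring

theorem tendsto_qPoch {q : ℝ} (a : ℝ) (hq : |q| < 1) :
    Tendsto (qPoch a q) atTop (nhds (qPochInf a q)) :=
  (multipliable_qPochInf a q hq).tendsto_prod_tprod_nat

theorem qPochInf_ne_zero {a q : ℝ} (hq0 : 0 < q) (hq1 : q < 1) (ha : a < 1) :
    qPochInf a q ≠ 0 := by
  have h : ∏' l : ℕ, (1 + -(a * q ^ l)) ≠ 0 := by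
    refine tprod_one_add_ne_zero_of_summable (fun i => ?_) ?_
    · have h0 : 0 < q ^ i := pow_pos hq0 i
      have h1 : q ^ i ≤ 1 := pow_le_one₀ hq0.le hq1.le
      rcases le_total a 0 with h | h <;> nlinarith
    · simpa [abs_mul, abs_of_pos hq0] using (summable_geometric_of_lt_one hq0.le hq1).mul_left |a|
  simpa [qPochInf, sub_eq_add_neg] using h

theorem weight_neg (q x : ℝ) : weight q (-x) = weight q x := by
  simp [weight, mul_comm (qPochInf (q * x) q)]

/-- The Pearson equation of the weight. Its factor matches the 1 - x² of `hermite_backward_shift`,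
which makes the Jackson sum of weight times polynomial telescope. -/
theorem weight_eq_mul_weight_mul {q : ℝ} (hq : |q| < 1) (x : ℝ) :
    weight q x = (1 - q ^ 2 * x ^ 2) * weight q (q * x) := by
  rw [weight, weight, qPochInf_eq_mul (a := q * x) hq, qPochInf_eq_mul (a := -(q * x)) hq,
    show q * -(q * x) = -(q * (q * x)) by ring]
  ring

theorem weight_one {q : ℝ} (hq0 : 0 < q) (hq1 : q < 1) :
    weight q 1 = (qPochInf (-1) q)⁻¹ := by
  have h1 := qPochInf_ne_zero hq0 hq1 hq1
  have h2 := qPochInf_ne_zero (a := -q) hq0 hq1 (by linarith)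
  have h3 := qPochInf_ne_zero (a := -1) hq0 hq1 (by linarith)
  rw [weight, mul_one]
  field_simp

theorem weight_pow {q : ℝ} (hq0 : 0 < q) (hq1 : q < 1) (k : ℕ) :
    weight q (q ^ k) = weight q 1 / qPoch (q ^ 2) (q ^ 2) k := by
  have hp : ∀ m, qPoch (q ^ 2) (q ^ 2) m ≠ 0 := fun m =>
    (qPoch_pos (by nlinarith) (by positivity) (by nlinarith) m).ne'
  induction k with
  | zero => simp [qPoch]
  | succ k ih =>
    have h := weight_eq_mul_weight_mul (q := q) (by rwa [abs_of_pos hq0]) (q ^ k)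
    have h1 := hp (k + 1)
    have h2 := hp k
    rw [qPoch_succ] at h1
    rw [ih, ← pow_succ'] at h
    rw [qPoch_succ, eq_div_iff h1]
    rw [div_eq_iff h2] at h
    rw [h]
    ring

/-- The weight along the lattice `q^k` converges. -/
theorem tendsto_weight_pow {q : ℝ} (hq0 : 0 < q) (hq1 : q < 1) :
    Tendsto (fun k : ℕ => weight q (q ^ k)) atTop
      (nhds (weight q 1 / qPochInf (q ^ 2) (q ^ 2))) := by
  have hsq : q ^ 2 < 1 := by nlinarith
  simp only [weight_pow hq0 hq1]
  exact tendsto_const_nhds.div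
    (tendsto_qPoch _ (by rwa [abs_of_pos (by positivity)]))
    (qPochInf_ne_zero (by positivity) hsq hsq)

theorem summable_pow_mul_of_tendsto {r : ℝ} (hr0 : 0 < r) (hr1 : r < 1) {g : ℕ → ℝ} {l : ℝ}
    (hg : Tendsto g atTop (nhds l)) : Summable fun k : ℕ => r ^ k * g k := by
  obtain ⟨B, hB⟩ := hg.norm.bddAbove_range
  refine Summable.of_norm_bounded ((summable_geometric_of_lt_one hr0.le hr1).mul_right B)
    fun k => ?_
  rw [norm_mul, norm_pow, Real.norm_of_nonneg hr0.le]
  exact mul_le_mul_of_nonneg_left (hB ⟨k, rfl⟩) (by positivity)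

theorem tendsto_comp_mul_pow {q : ℝ} (hq0 : 0 < q) (hq1 : q < 1) {f : ℝ → ℝ} (hf : Continuous f)
    (c : ℝ) : Tendsto (fun k : ℕ => f (c * q ^ k)) atTop (nhds (f 0)) := by
  have h := (tendsto_pow_atTop_nhds_zero_of_lt_one hq0.le hq1).const_mul c
  rw [mul_zero] at h
  exact (hf.tendsto 0).comp h

theorem summable_lattice {q : ℝ} (hq0 : 0 < q) (hq1 : q < 1) {f : ℝ → ℝ} (hf : Continuous f)
    (c : ℝ) : Summable fun k : ℕ => q ^ k * (weight q (q ^ k) * f (c * q ^ k)) :=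
  summable_pow_mul_of_tendsto hq0 hq1
    ((tendsto_weight_pow hq0 hq1).mul (tendsto_comp_mul_pow hq0 hq1 hf c))

/-! ### The orthogonality functional and its vanishing in positive degree. -/

/-- The orthogonality functional `(1-q)^{-1} ∫_{-1}^1 f(x) ω(x) d_q x`. -/
def functional (q : ℝ) (f : ℝ → ℝ) : ℝ :=
  ∑' k : ℕ, (q ^ k * (weight q (q ^ k) * f (1 * q ^ k)) +
    q ^ k * (weight q (q ^ k) * f (-1 * q ^ k)))

theorem summable_functional {q : ℝ} (hq0 : 0 < q) (hq1 : q < 1) {f : ℝ → ℝ} (hf : Continuous f) :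
    Summable fun k : ℕ => (q ^ k * (weight q (q ^ k) * f (1 * q ^ k)) +
      q ^ k * (weight q (q ^ k) * f (-1 * q ^ k))) :=
  (summable_lattice hq0 hq1 hf 1).add (summable_lattice hq0 hq1 hf (-1))

theorem functional_add {q : ℝ} (hq0 : 0 < q) (hq1 : q < 1) {f g : ℝ → ℝ} (hf : Continuous f)
    (hg : Continuous g) :
    functional q (fun x => f x + g x) = functional q f + functional q g := by
  rw [functional, functional, functional,
    ← (summable_functional hq0 hq1 hf).tsum_add (summable_functional hq0 hq1 hg)]
  congr 1; ext k; ring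

theorem functional_const_mul (q c : ℝ) (f : ℝ → ℝ) :
    functional q (fun x => c * f x) = c * functional q f := by
  rw [functional, functional, ← tsum_mul_left]
  congr 1; ext k; ring

theorem functional_sum {q : ℝ} (hq0 : 0 < q) (hq1 : q < 1) {ι : Type*} (s : Finset ι)
    {f : ι → ℝ → ℝ} (hf : ∀ i, Continuous (f i)) :
    functional q (fun x => ∑ i ∈ s, f i x) = ∑ i ∈ s, functional q (f i) := by
  classical
  induction s using Finset.induction_on with
  | empty => simp [functional]
  | insert a s ha ih =>
    simp only [Finset.sum_insert ha]
    rw [functional_add hq0 hq1 (hf a) (by fun_prop), ih]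

theorem lattice_term_eq (q : ℝ) (f : ℝ → ℝ) (c : ℝ) (hc : c = 1 ∨ c = -1) (k : ℕ) :
    c * q ^ k * (f (c * q ^ k) * weight q (c * q ^ k)) =
      c * (q ^ k * (weight q (q ^ k) * f (c * q ^ k))) := by
  have h : weight q (c * q ^ k) = weight q (q ^ k) := by
    rcases hc with rfl | rfl
    · rw [one_mul]
    · rw [neg_one_mul, weight_neg]
  rw [h]; ring

theorem jacksonIntegrable_mul_weight {q : ℝ} (hq0 : 0 < q) (hq1 : q < 1) {f : ℝ → ℝ}
    (hf : Continuous f) : JacksonIntegrable q (-1) 1 fun x => f x * weight q x := by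
  constructor
  · simp_rw [lattice_term_eq q f 1 (Or.inl rfl)]
    exact (summable_lattice hq0 hq1 hf 1).mul_left _
  · simp_rw [lattice_term_eq q f (-1) (Or.inr rfl)]
    exact (summable_lattice hq0 hq1 hf (-1)).mul_left _

theorem jacksonIntegral_mul_weight {q : ℝ} (hq0 : 0 < q) (hq1 : q < 1) {f : ℝ → ℝ}
    (hf : Continuous f) :
    jacksonIntegral q (-1) 1 (fun x => f x * weight q x) = (1 - q) * functional q f := by
  rw [jacksonIntegral, jacksonFromZero, jacksonFromZero]
  simp_rw [lattice_term_eq q f 1 (Or.inl rfl), lattice_term_eq q f (-1) (Or.inr rfl)]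
  rw [tsum_mul_left, tsum_mul_left, functional,
    (summable_lattice hq0 hq1 hf 1).tsum_add (summable_lattice hq0 hq1 hf (-1))]
  ring

/-- The functional annihilates the polynomials of positive degree. -/
theorem functional_hermite_succ {q : ℝ} (hq0 : 0 < q) (hq1 : q < 1) (n : ℕ) :
    functional q (hermite (n + 1) q) = 0 := by
  -- Telescoping: the backward shift writes each summand as a difference of consecutive values of
  -- the right-hand side, and at the endpoint x = c the factor 1 - x² kills the outer boundary term.
  have hpart : ∀ (c : ℝ), c ^ 2 = 1 → ∀ K : ℕ, ∑ k ∈ Finset.range (K + 1),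
      q ^ k * (weight q (q ^ k) * hermite (n + 1) q (c * q ^ k)) =
        c * q ^ n * (weight q (q ^ K) * hermite n q (c * q ^ K)) := by
    intro c hc K
    induction K with
    | zero =>
      have h := hermite_backward_shift hq0 hq1 n c
      rw [hc, sub_self, zero_mul, sub_zero] at h
      simp only [zero_add, Finset.sum_range_one, pow_zero, mul_one, one_mul]
      linear_combination (-c * weight q 1) * h - weight q 1 * hermite (n + 1) q c * hc
    | succ K ih =>
      rw [Finset.sum_range_succ, ih]
      have h := hermite_backward_shift hq0 hq1 n (c * q ^ (K + 1))
      have hw := weight_eq_mul_weight_mul (q := q) (by rwa [abs_of_pos hq0]) (q ^ K)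
      rw [← pow_succ'] at hw
      rw [show c * q ^ (K + 1) / q = c * q ^ K by rw [pow_succ]; field_simp] at h
      rw [hw]
      set x := c * q ^ (K + 1)
      have hx : x ^ 2 = q ^ 2 * (q ^ K) ^ 2 := by
        simp only [x, mul_pow, hc]; ring
      have hcx : c * x = q ^ (K + 1) := by
        simp only [x]; linear_combination q ^ (K + 1) * hc
      rw [hx] at h
      linear_combination (-c * weight q (q ^ (K + 1))) * h -
        weight q (q ^ (K + 1)) * hermite (n + 1) q x * hcx
  have hs := summable_functional hq0 hq1 (continuous_hermite (n + 1) q)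
  have hlim := (hs.hasSum.tendsto_sum_nat).comp (tendsto_add_atTop_nat 1)
  refine tendsto_nhds_unique hlim ?_
  -- The inner boundary terms of the two halves both converge to multiples of H_n(0), with opposite
  -- signs.
  have hzero : (0 : ℝ) = 1 * q ^ n * (weight q 1 / qPochInf (q ^ 2) (q ^ 2) * hermite n q 0) +
      -1 * q ^ n * (weight q 1 / qPochInf (q ^ 2) (q ^ 2) * hermite n q 0) := by ring
  rw [hzero]
  have ht := fun c : ℝ => ((tendsto_weight_pow hq0 hq1).mul
    (tendsto_comp_mul_pow hq0 hq1 (continuous_hermite n q) c)).const_mul (c * q ^ n)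
  refine ((ht 1).add (ht (-1))).congr fun K => ?_
  simp only [Function.comp_apply, Finset.sum_add_distrib]
  rw [hpart 1 (by norm_num), hpart (-1) (by norm_num)]

/-! ### Total mass of the weight. -/

/-- Euler's identity `(q;q²)_∞ (-q;q)_∞ = 1`. -/
theorem qPochInf_mul_qPochInf_eq_one {q : ℝ} (hq0 : 0 < q) (hq1 : q < 1) :
    qPochInf q (q ^ 2) * qPochInf (-q) q = 1 := by
  -- Finite form: (-q;q)_m (q;q)_m = (q²;q²)_m supplies the even exponents of (q;q)_{2m}, and
  -- (q;q²)_m the odd ones.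
  have hfin : ∀ m : ℕ, qPoch q (q ^ 2) m * qPoch (-q) q m * qPoch q q m = qPoch q q (2 * m) := by
    intro m
    induction m with
    | zero => simp [qPoch]
    | succ m ih =>
      rw [show 2 * (m + 1) = 2 * m + 1 + 1 by ring]
      simp only [qPoch_succ]
      rw [← ih]
      ring
  have ha : |q| < 1 := by rwa [abs_of_pos hq0]
  have ha2 : |q ^ 2| < 1 := by rw [abs_of_pos (by positivity)]; nlinarith
  have h1 := ((tendsto_qPoch q ha2).mul (tendsto_qPoch (-q) ha)).mul (tendsto_qPoch q ha)
  have h2 : Tendsto (fun m => qPoch q q (2 * m)) atTop (nhds (qPochInf q q)) :=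
    (tendsto_qPoch q ha).comp (tendsto_id.const_mul_atTop' (by norm_num))
  have h3 := tendsto_nhds_unique h1 (h2.congr fun m => (hfin m).symm)
  exact mul_right_cancel₀ (qPochInf_ne_zero hq0 hq1 hq1) (by rw [h3, one_mul])

/-- Euler's series ∑ z^k/(q²;q²)_k = 1/(z;q²)_∞ at z = q, followed by Euler's identity. The series
at z = q^(2m+1) gains the factor 1 - q^(2m+1) as m increases by one, and tends to its constant term
1 as m → ∞. -/
theorem tsum_pow_div_qPoch {q : ℝ} (hq0 : 0 < q) (hq1 : q < 1) :
    ∑' k : ℕ, q ^ k * (qPoch (q ^ 2) (q ^ 2) k)⁻¹ = qPochInf (-q) q := by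
  have hsq : q ^ 2 < 1 := by nlinarith
  have ha2 : |q ^ 2| < 1 := by rwa [abs_of_pos (by positivity)]
  have hp : ∀ m, qPoch (q ^ 2) (q ^ 2) m ≠ 0 := fun m =>
    (qPoch_pos hsq (by positivity) hsq.le m).ne'
  have hinv := (tendsto_qPoch (q ^ 2) ha2).inv₀ (qPochInf_ne_zero (by positivity) hsq hsq)
  have hs : ∀ m : ℕ, Summable fun k : ℕ => (q ^ (2 * m + 1)) ^ k * (qPoch (q ^ 2) (q ^ 2) k)⁻¹ :=
    fun m => summable_pow_mul_of_tendsto (by positivity) (pow_lt_one₀ hq0.le hq1 (by omega)) hinv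
  set M : ℕ → ℝ := fun m => ∑' k : ℕ, (q ^ (2 * m + 1)) ^ k * (qPoch (q ^ 2) (q ^ 2) k)⁻¹ with hM
  have hrec : ∀ m, M (m + 1) = M m * (1 - q * (q ^ 2) ^ m) := by
    intro m
    have h1 : M m - M (m + 1) = ∑' k : ℕ, ((q ^ (2 * m + 1)) ^ k * (qPoch (q ^ 2) (q ^ 2) k)⁻¹ -
      (q ^ (2 * (m + 1) + 1)) ^ k * (qPoch (q ^ 2) (q ^ 2) k)⁻¹) := ((hs m).tsum_sub (hs (m + 1))).symm
    rw [((hs m).sub (hs (m + 1))).tsum_eq_zero_add] at h1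
    have h2 : ∀ k : ℕ, (q ^ (2 * m + 1)) ^ (k + 1) * (qPoch (q ^ 2) (q ^ 2) (k + 1))⁻¹ -
      (q ^ (2 * (m + 1) + 1)) ^ (k + 1) * (qPoch (q ^ 2) (q ^ 2) (k + 1))⁻¹ =
        q ^ (2 * m + 1) * ((q ^ (2 * m + 1)) ^ k * (qPoch (q ^ 2) (q ^ 2) k)⁻¹) := by
      intro k
      have e1 := hp (k + 1)
      have e2 := hp k
      rw [qPoch_succ] at e1 ⊢
      rw [← sub_mul, mul_inv_eq_iff_eq_mul₀ e1]
      field_simp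
      ring
    simp only [h2, tsum_mul_left, pow_zero, sub_self, zero_add] at h1
    change M m - M (m + 1) = q ^ (2 * m + 1) * M m at h1
    rw [← pow_mul]
    linear_combination -h1
  have hprod : ∀ m, M m = M 0 * qPoch q (q ^ 2) m := by
    intro m
    induction m with
    | zero => simp [qPoch]
    | succ m ih => rw [hrec, ih, qPoch_succ]; ring
  have hlim1 : Tendsto M atTop (nhds (∑' k : ℕ, if k = 0 then 1 else 0)) := by
    refine tendsto_tsum_of_dominated_convergence
      (bound := fun k => (q ^ (2 * 0 + 1)) ^ k * (qPoch (q ^ 2) (q ^ 2) k)⁻¹) (hs 0) ?_ ?_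
    · intro k
      rcases Nat.eq_zero_or_pos k with rfl | hk
      · simp [qPoch]
      · rw [if_neg hk.ne', ← zero_mul ((qPoch (q ^ 2) (q ^ 2) k)⁻¹)]
        refine Tendsto.mul_const _ ?_
        have h0 := (tendsto_pow_atTop_nhds_zero_of_lt_one hq0.le hq1).comp
          (tendsto_atTop_mono (fun m : ℕ => (by nlinarith : m ≤ (2 * m + 1) * k)) tendsto_id)
        refine h0.congr fun m => ?_
        simp [pow_mul]
    · refine Eventually.of_forall fun m k => ?_
      have hpos := qPoch_pos hsq (by positivity) hsq.le k
      rw [Real.norm_of_nonneg (by positivity)]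
      refine mul_le_mul_of_nonneg_right ?_ (by positivity)
      refine pow_le_pow_left₀ (by positivity) ?_ k
      exact pow_le_pow_of_le_one hq0.le hq1.le (by omega)
  rw [tsum_ite_eq] at hlim1
  have hlim2 : Tendsto M atTop (nhds (M 0 * qPochInf q (q ^ 2))) :=
    ((tendsto_qPoch q ha2).const_mul _).congr fun m => (hprod m).symm
  have hone := tendsto_nhds_unique hlim1 hlim2
  have heuler := qPochInf_mul_qPochInf_eq_one hq0 hq1
  have hM0 : M 0 = ∑' k : ℕ, q ^ k * (qPoch (q ^ 2) (q ^ 2) k)⁻¹ := by simp [hM]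
  rw [← hM0]
  linear_combination (-M 0) * heuler - qPochInf (-q) q * hone

theorem functional_one {q : ℝ} (hq0 : 0 < q) (hq1 : q < 1) :
    functional q (fun _ => 1) = 1 := by
  have h2 := qPochInf_ne_zero (a := -q) hq0 hq1 (by linarith)
  have h : ∀ k : ℕ, q ^ k * (weight q (q ^ k) * 1) + q ^ k * (weight q (q ^ k) * 1) =
      2 * weight q 1 * (q ^ k * (qPoch (q ^ 2) (q ^ 2) k)⁻¹) := by
    intro k; rw [weight_pow hq0 hq1]; ring
  rw [functional]
  simp only [h]
  rw [tsum_mul_left, tsum_pow_div_qPoch hq0 hq1, weight_one hq0 hq1,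
    qPochInf_eq_mul (a := -1) (by rwa [abs_of_pos hq0]), mul_neg_one]
  field_simp
  norm_num

/-! ### Norms and orthogonality. -/

/-- The squared norm `(q;q)_n q^{n(n-1)/2}` of the polynomial of degree `n`. -/
def normSq (q : ℝ) (n : ℕ) : ℝ := qPoch q q n * q ^ (n * (n - 1) / 2)

theorem normSq_zero (q : ℝ) : normSq q 0 = 1 := by simp [normSq, qPoch]

theorem normSq_succ (q : ℝ) (n : ℕ) : normSq q (n + 1) = recCoeff q (n + 1) * normSq q n := by
  have h : (n + 1) * (n + 1 - 1) / 2 = n * (n - 1) / 2 + n := by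
    have := Nat.triangle_succ n
    simpa using this
  rw [normSq, normSq, recCoeff, h, qPoch_succ, pow_add, Nat.add_sub_cancel]
  ring

theorem normSq_pos {q : ℝ} (hq0 : 0 < q) (hq1 : q < 1) (n : ℕ) : 0 < normSq q n :=
  mul_pos (qPoch_pos hq1 hq0.le hq1.le n) (by positivity)

theorem functional_mul_hermite_mul {q : ℝ} (hq0 : 0 < q) (hq1 : q < 1) {g : ℝ → ℝ}
    (hg : Continuous g) (n : ℕ) :
    functional q (fun x => x * hermite n q x * g x) =
      functional q (fun x => hermite (n + 1) q x * g x) +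
        recCoeff q n * functional q (fun x => hermite (n - 1) q x * g x) := by
  rw [← functional_const_mul, ← functional_add hq0 hq1 (by fun_prop) (by fun_prop)]
  congr 1; ext x
  rw [mul_hermite hq0 hq1]; ring

/-- Multiplication by x is symmetric for the functional, so a degree can be moved from the left
factor to the right one. Iterating lowers the left degree to 0. -/
theorem functional_hermite_succ_mul_hermite {q : ℝ} (hq0 : 0 < q) (hq1 : q < 1) (j k : ℕ) :
    functional q (fun x => hermite (j + 1) q x * hermite k q x) =
      functional q (fun x => hermite j q x * hermite (k + 1) q x) +
        recCoeff q k * functional q (fun x => hermite j q x * hermite (k - 1) q x) -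
        recCoeff q j * functional q (fun x => hermite (j - 1) q x * hermite k q x) := by
  have h1 := functional_mul_hermite_mul hq0 hq1 (continuous_hermite k q) j
  have h2 := functional_mul_hermite_mul hq0 hq1 (continuous_hermite j q) k
  have h3 : (fun x => x * hermite j q x * hermite k q x) =
      fun x => x * hermite k q x * hermite j q x := by ext x; ring
  rw [h3, h2] at h1
  simp only [mul_comm (hermite (k + 1) q _), mul_comm (hermite (k - 1) q _)] at h1
  linear_combination -h1

theorem functional_hermite_mul_of_lt {q : ℝ} (hq0 : 0 < q) (hq1 : q < 1) :
    ∀ j k : ℕ, j < k → functional q (fun x => hermite j q x * hermite k q x) = 0 := by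
  intro j
  induction j using Nat.strong_induction_on with
  | _ j ih =>
    intro k hk
    match j with
    | 0 =>
      obtain ⟨n, rfl⟩ := Nat.exists_eq_succ_of_ne_zero (Nat.pos_iff_ne_zero.1 hk)
      simpa [hermite_zero] using functional_hermite_succ hq0 hq1 n
    | j + 1 =>
      rw [functional_hermite_succ_mul_hermite hq0 hq1, ih j (by omega) _ (by omega),
        ih j (by omega) _ (by omega), ih (j - 1) (by omega) _ (by omega)]
      ring

/-- Orthogonality of the discrete `q`-Hermite polynomials. -/
theorem functional_hermite_mul_hermite {q : ℝ} (hq0 : 0 < q) (hq1 : q < 1) (j k : ℕ) :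
    functional q (fun x => hermite j q x * hermite k q x) = if j = k then normSq q k else 0 := by
  rcases lt_trichotomy j k with h | rfl | h
  · rw [functional_hermite_mul_of_lt hq0 hq1 _ _ h, if_neg h.ne]
  · rw [if_pos rfl]
    induction j with
    | zero => simpa [hermite_zero, normSq_zero] using functional_one hq0 hq1
    | succ j ih =>
      rw [functional_hermite_succ_mul_hermite hq0 hq1, Nat.add_sub_cancel, ih,
        functional_hermite_mul_of_lt hq0 hq1 j _ (by omega),
        functional_hermite_mul_of_lt hq0 hq1 (j - 1) _ (by omega), normSq_succ]
      ring
  · rw [if_neg h.ne', ← functional_hermite_mul_of_lt hq0 hq1 _ _ h]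
    simp only [mul_comm]

/-! ### Moments through the functional, convergence and rescaling. -/

theorem moment_integrand_eq (N p : ℕ) (q : ℝ) :
    (fun x => |x| ^ (2 * p) * density N q x) = fun x => (1 / (1 - q) *
      ∑ j ∈ Finset.range N, (normSq q j)⁻¹ * (x ^ (2 * p) * hermite j q x * hermite j q x)) *
        weight q x := by
  ext x
  rw [Even.pow_abs (even_two_mul p), density, Finset.mul_sum, ← mul_assoc, Finset.mul_sum,
    Finset.mul_sum]
  congr 1
  refine Finset.sum_congr rfl fun j _ => ?_
  rw [normSq]; ring

theorem continuous_moment_integrand (N p : ℕ) (q : ℝ) : Continuous fun x => 1 / (1 - q) *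
    ∑ j ∈ Finset.range N, (normSq q j)⁻¹ * (x ^ (2 * p) * hermite j q x * hermite j q x) := by
  fun_prop

theorem jacksonIntegrable_moment {q : ℝ} (hq0 : 0 < q) (hq1 : q < 1) (N p : ℕ) :
    JacksonIntegrable q (-1) 1 fun x => |x| ^ (2 * p) * density N q x := by
  rw [moment_integrand_eq]
  exact jacksonIntegrable_mul_weight hq0 hq1 (continuous_moment_integrand N p q)

theorem momentHat_term_eq {q : ℝ} (hq1 : q < 1) (N p k : ℕ) (c : ℝ) :
    c / √(1 - q) * q ^ k * (|c / √(1 - q) * q ^ k| ^ (2 * p) *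
      densityHat N q (c / √(1 - q) * q ^ k)) =
    ((1 - q) ^ p)⁻¹ * (c * q ^ k * (|c * q ^ k| ^ (2 * p) * density N q (c * q ^ k))) := by
  have hs : 0 < √(1 - q) := Real.sqrt_pos.2 (by linarith)
  have hsq : (1 - q) ^ p = √(1 - q) ^ (2 * p) := by
    rw [pow_mul, Real.sq_sqrt (by linarith)]
  rw [densityHat, show √(1 - q) * (c / √(1 - q) * q ^ k) = c * q ^ k by field_simp,
    show c / √(1 - q) * q ^ k = c * q ^ k / √(1 - q) by ring, abs_div, abs_of_pos hs, div_pow, hsq]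
  field_simp

theorem jacksonIntegrable_momentHat {q : ℝ} (hq0 : 0 < q) (hq1 : q < 1) (N p : ℕ) :
    JacksonIntegrable q (-1 / √(1 - q)) (1 / √(1 - q))
      fun x => |x| ^ (2 * p) * densityHat N q x := by
  have h := jacksonIntegrable_moment hq0 hq1 N p
  constructor
  · simp_rw [momentHat_term_eq hq1 N p _ 1]
    exact h.1.mul_left _
  · simp_rw [momentHat_term_eq hq1 N p _ (-1)]
    exact h.2.mul_left _

theorem momentHat_eq {q : ℝ} (hq1 : q < 1) (N p : ℕ) :
    momentHat N p q = ((1 - q) ^ p)⁻¹ * moment N p q := by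
  rw [momentHat, moment, jacksonIntegral, jacksonIntegral]
  simp only [jacksonFromZero]
  simp_rw [momentHat_term_eq hq1 N p _ 1, momentHat_term_eq hq1 N p _ (-1), tsum_mul_left]
  ring

theorem moment_eq_sum {q : ℝ} (hq0 : 0 < q) (hq1 : q < 1) (N p : ℕ) :
    moment N p q = ∑ j ∈ Finset.range N,
      (normSq q j)⁻¹ * functional q (fun x => x ^ (2 * p) * hermite j q x * hermite j q x) := by
  rw [moment, moment_integrand_eq, jacksonIntegral_mul_weight hq0 hq1
    (continuous_moment_integrand N p q), functional_const_mul,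
    functional_sum hq0 hq1 _ (fun i => by fun_prop)]
  simp only [functional_const_mul]
  have : 1 - q ≠ 0 := by linarith
  field_simp

/-! ### Lattice path expansion of the moments. -/

/-- The increment of an up-step (`true`) or a down-step (`false`). -/
def step (b : Bool) : ℤ := if b then 1 else -1

/-- The height of a lattice path immediately before its step `i`. -/
def height {m : ℕ} (σ : Fin m → Bool) (i : Fin m) : ℤ :=
  ∑ k, if k < i then step (σ k) else 0

/-- The sum over the lattice paths with `m` steps and total displacement `s`, in which a down-step
from `x + h` has weight `V (x + h)`. -/
def pathSum (V : ℝ → ℝ) (m : ℕ) (x : ℝ) (s : ℤ) : ℝ :=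
  ∑ σ : Fin m → Bool, if ∑ i, step (σ i) = s then
    ∏ i, (if σ i then 1 else V (x + height σ i)) else 0

theorem height_cons_zero {m : ℕ} (b : Bool) (σ : Fin m → Bool) :
    height (Fin.cons b σ : Fin (m + 1) → Bool) 0 = 0 := by
  simp [height]

theorem height_cons_succ {m : ℕ} (b : Bool) (σ : Fin m → Bool) (i : Fin m) :
    height (Fin.cons b σ : Fin (m + 1) → Bool) i.succ = step b + height σ i := by
  simp [height, Fin.sum_univ_succ]

theorem pathSum_zero (V : ℝ → ℝ) (x : ℝ) (s : ℤ) :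
    pathSum V 0 x s = if s = 0 then 1 else 0 := by
  simp only [pathSum, Finset.univ_eq_empty, Finset.sum_empty, Finset.prod_empty,
    Finset.univ_unique, Finset.sum_const, Finset.card_singleton, one_smul, @eq_comm ℤ 0]

theorem pathSum_succ (V : ℝ → ℝ) (m : ℕ) (x : ℝ) (s : ℤ) :
    pathSum V (m + 1) x s = pathSum V m (x + 1) (s - 1) + V x * pathSum V m (x - 1) (s + 1) := by
  rw [pathSum, ← (Fin.consEquiv fun _ => Bool).sum_comp, Fintype.sum_prod_type,
    Fintype.sum_bool, pathSum, pathSum, Finset.mul_sum]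
  congr 1
  · refine Finset.sum_congr rfl fun σ _ => ?_
    have hcons : (Fin.consEquiv fun _ => Bool) (true, σ) = (Fin.cons true σ : Fin (m + 1) → Bool) := rfl
    have hc : (step true + ∑ i, step (σ i) = s) ↔ ∑ i, step (σ i) = s - 1 := by
      rw [step]; constructor <;> intro h <;> simp at * <;> omega
    simp only [hcons, Fin.sum_univ_succ, Fin.prod_univ_succ, Fin.cons_zero,
      Fin.cons_succ, height_cons_succ, hc]
    simp [step, add_assoc]
  · refine Finset.sum_congr rfl fun σ _ => ?_
    have hcons : (Fin.consEquiv fun _ => Bool) (false, σ) = (Fin.cons false σ : Fin (m + 1) → Bool) := rfl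
    have hc : (step false + ∑ i, step (σ i) = s) ↔ ∑ i, step (σ i) = s + 1 := by
      rw [step]; constructor <;> intro h <;> simp at * <;> omega
    simp only [hcons, Fin.sum_univ_succ, Fin.prod_univ_succ, Fin.cons_zero,
      Fin.cons_succ, height_cons_succ, height_cons_zero, hc]
    simp [step, sub_eq_add_neg, add_assoc]

/-- Entries of the m-th power of the Jacobi matrix. No positivity of the paths is required: a path
leaving the naturals takes a down-step from 0, of weight `V 0 = recCoeff q 0 = 0`. -/
theorem functional_pow_mul_hermite {q : ℝ} (hq0 : 0 < q) (hq1 : q < 1) {V : ℝ → ℝ}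
    (hV : ∀ n : ℕ, V n = recCoeff q n) (m j k : ℕ) :
    functional q (fun x => x ^ m * hermite j q x * hermite k q x) =
      normSq q k * pathSum V m j ((k : ℤ) - j) := by
  induction m generalizing j with
  | zero =>
    simp only [pow_zero, one_mul, functional_hermite_mul_hermite hq0 hq1, pathSum_zero]
    by_cases h : j = k
    · simp [h]
    · rw [if_neg h, if_neg (by omega), mul_zero]
  | succ m ih =>
    have h := functional_mul_hermite_mul hq0 hq1 (g := fun x => x ^ m * hermite k q x)
      (by fun_prop) j
    have e : ∀ n : ℕ, (fun x => hermite n q x * (x ^ m * hermite k q x)) =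
        fun x => x ^ m * hermite n q x * hermite k q x := fun n => by ext x; ring
    have e' : (fun x => x * hermite j q x * (x ^ m * hermite k q x)) =
        fun x => x ^ (m + 1) * hermite j q x * hermite k q x := by ext x; ring
    rw [e', e, e, ih, ih] at h
    rw [h, pathSum_succ, hV]
    -- At j = 0 both the truncated index `0 - 1` and the path continued from -1 carry the factor 0.
    cases j with
    | zero => rw [recCoeff_zero]; push_cast; ring_nf
    | succ j =>
      rw [Nat.add_sub_cancel]; push_cast
      rw [show (k : ℤ) - (j + 1 + 1) = k - (j + 1) - 1 by ring,
        show (k : ℤ) - (j + 1) + 1 = k - j by ring, show (j : ℝ) + 1 - 1 = j by ring]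
      ring

/-- The closed lattice paths with `2p` steps. -/
def bridges (p : ℕ) : Finset (Fin (2 * p) → Bool) :=
  Finset.univ.filter fun σ => ∑ i, step (σ i) = 0

theorem mem_bridges {p : ℕ} {σ : Fin (2 * p) → Bool} : σ ∈ bridges p ↔ ∑ i, step (σ i) = 0 := by
  simp [bridges]

/-- The down-steps of a lattice path. -/
def downs {m : ℕ} (σ : Fin m → Bool) : Finset (Fin m) :=
  Finset.univ.filter fun i => σ i = false

theorem sum_step {m : ℕ} (σ : Fin m → Bool) :
    ∑ i, step (σ i) = (m : ℤ) - 2 * (downs σ).card := by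
  have h : ∀ i, step (σ i) = 1 - 2 * (if σ i = false then 1 else 0) := by
    intro i; cases σ i <;> simp [step]
  simp only [h, Finset.sum_sub_distrib, ← Finset.mul_sum]
  simp [downs]

theorem mem_bridges_iff_card {p : ℕ} {σ : Fin (2 * p) → Bool} :
    σ ∈ bridges p ↔ (downs σ).card = p := by
  rw [mem_bridges, sum_step]; push_cast; omega

theorem pathSum_bridges (V : ℝ → ℝ) (p : ℕ) (x : ℝ) :
    pathSum V (2 * p) x 0 = ∑ σ ∈ bridges p, ∏ i ∈ downs σ, V (x + height σ i) := by
  rw [pathSum, bridges, Finset.sum_filter]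
  refine Finset.sum_congr rfl fun σ _ => ?_
  congr 1
  rw [downs, Finset.prod_filter]
  refine Finset.prod_congr rfl fun i _ => ?_
  cases σ i <;> simp

/-- The rescaled recurrence coefficient `q^y - q^{2y}` at `q = e^{-θ}`. -/
def profile (θ y : ℝ) : ℝ := Real.exp (-(θ * y)) - Real.exp (-(2 * θ * y))

/-- The offset from the starting point of the midpoint of a down-step `i`. -/
def midpoint {m : ℕ} (σ : Fin m → Bool) (i : Fin m) : ℝ := height σ i - 1 / 2

theorem pow_mul_moment_eq {θ : ℝ} (hθ : 0 < θ) (N p : ℕ) :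
    Real.exp (-θ) ^ p * moment N p (Real.exp (-θ)) = ∑ j ∈ Finset.range N, ∑ σ ∈ bridges p,
      ∏ i ∈ downs σ, profile θ (j + 1 / 2 + midpoint σ i) := by
  set q := Real.exp (-θ) with hq
  have hq0 : 0 < q := Real.exp_pos _
  have hq1 : q < 1 := Real.exp_lt_one_iff.2 (by linarith)
  -- The p down-steps produce the factor (q⁻¹)^p, which the prefactor q^p of the statement removes.
  have hV : ∀ n : ℕ, (fun y => q⁻¹ * profile θ y) (n : ℝ) = recCoeff q n := by
    intro n
    have e1 : Real.exp (-(θ * n)) = q ^ n := by rw [hq, ← Real.exp_nat_mul]; congr 1; ring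
    have e2 : Real.exp (-(2 * θ * n)) = q ^ n * q ^ n := by
      rw [← e1, ← Real.exp_add]; congr 1; ring
    simp only [profile, e1, e2, recCoeff]
    cases n with
    | zero => simp
    | succ n => rw [Nat.add_sub_cancel, pow_succ]; field_simp
  rw [moment_eq_sum hq0 hq1, Finset.mul_sum]
  refine Finset.sum_congr rfl fun j _ => ?_
  rw [functional_pow_mul_hermite hq0 hq1 (V := fun y => q⁻¹ * profile θ y) hV, sub_self, pathSum_bridges,
    inv_mul_cancel_left₀ (normSq_pos hq0 hq1 j).ne', Finset.mul_sum]
  refine Finset.sum_congr rfl fun σ hσ => ?_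
  rw [Finset.prod_mul_distrib, Finset.prod_const, mem_bridges_iff_card.1 hσ, ← mul_assoc,
    ← mul_pow, mul_inv_cancel₀ hq0.ne', one_pow, one_mul]
  refine Finset.prod_congr rfl fun i _ => ?_
  rw [midpoint]; congr 1; ring

/-! ### Second moments of closed lattice paths. -/

theorem card_bridges (p : ℕ) : (bridges p).card = (2 * p).choose p := by
  have h : (bridges p).card = (Finset.powersetCard p (Finset.univ : Finset (Fin (2 * p)))).card := by
    refine Finset.card_nbij' downs (fun t i => decide (i ∉ t)) ?_ ?_ ?_ ?_
    · intro σ hσ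
      simpa [Finset.mem_powersetCard] using mem_bridges_iff_card.1 hσ
    · intro t ht
      have : downs (fun i => decide (i ∉ t)) = t := by ext i; simp [downs]
      simp only [Finset.mem_coe, mem_bridges_iff_card, this]
      exact (Finset.mem_powersetCard.1 ht).2
    · intro σ _
      ext i; simp [downs]
    · intro t _
      ext i; simp [downs]
  rw [h, Finset.card_powersetCard, Finset.card_univ, Fintype.card_fin]

theorem sum_bridges_comp_perm {p : ℕ} (π : Equiv.Perm (Fin (2 * p)))
    (F : (Fin (2 * p) → Bool) → ℝ) :
    ∑ σ ∈ bridges p, F (σ ∘ π) = ∑ σ ∈ bridges p, F σ := by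
  refine Finset.sum_nbij' (fun σ => σ ∘ π) (fun σ => σ ∘ π.symm) ?_ ?_ ?_ ?_ ?_
  · intro σ hσ
    rw [mem_bridges] at hσ ⊢
    simpa only [Function.comp_apply, Equiv.sum_comp π fun i => step (σ i)] using hσ
  · intro σ hσ
    rw [mem_bridges] at hσ ⊢
    simpa only [Function.comp_apply, Equiv.sum_comp π.symm fun i => step (σ i)] using hσ
  · intro σ _; ext i; simp
  · intro σ _; ext i; simp
  · intro σ _; rfl

theorem step_mul_self (b : Bool) : (step b : ℝ) * step b = 1 := by cases b <;> simp [step]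

theorem sum_step_of_mem {p : ℕ} {σ : Fin (2 * p) → Bool} (hσ : σ ∈ bridges p) :
    ∑ i, (step (σ i) : ℝ) = 0 := by
  exact_mod_cast mem_bridges.1 hσ

/-- The covariance of two distinct steps of a closed lattice path. -/
theorem sum_bridges_step_mul_step {p : ℕ} {i k : Fin (2 * p)} (hik : i ≠ k) :
    (2 * p - 1) * ∑ σ ∈ bridges p, (step (σ i) : ℝ) * step (σ k) = -((2 * p).choose p : ℝ) := by
  -- Exchangeability: transposing k and l fixes i, so all covariances with step i agree off the
  -- diagonal. They sum to zero with the diagonal one, because a closed path has zero total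
  -- displacement.
  have hall : ∀ l : Fin (2 * p), ∑ σ ∈ bridges p, (step (σ i) : ℝ) * step (σ l) =
      if l = i then ((2 * p).choose p : ℝ) else
        ∑ σ ∈ bridges p, (step (σ i) : ℝ) * step (σ k) := by
    intro l
    by_cases h : l = i
    · subst h
      simp [step_mul_self, card_bridges]
    · rw [if_neg h, ← sum_bridges_comp_perm (Equiv.swap k l)]
      refine Finset.sum_congr rfl fun σ _ => ?_
      simp [Equiv.swap_apply_of_ne_of_ne hik (Ne.symm h)]
  have hsum : ∑ l, ∑ σ ∈ bridges p, (step (σ i) : ℝ) * step (σ l) = 0 := by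
    rw [Finset.sum_comm]
    refine Finset.sum_eq_zero fun σ hσ => ?_
    rw [← Finset.mul_sum, sum_step_of_mem hσ, mul_zero]
  rw [Finset.sum_congr rfl fun l _ => hall l, Finset.sum_ite, Finset.sum_const, Finset.sum_const, Finset.filter_eq', if_pos (Finset.mem_univ i),
    Finset.filter_ne', Finset.card_erase_of_mem (Finset.mem_univ i), Finset.card_univ,
    Fintype.card_fin, nsmul_eq_mul, nsmul_eq_mul, Nat.cast_sub (by have := i.2; omega)] at hsum
  push_cast [Finset.card_singleton] at hsum
  linarith

/-- The second moment of a linear statistic of the steps of a closed lattice path. -/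
theorem sum_bridges_linear_sq {p : ℕ} (c : Fin (2 * p) → ℝ) :
    (2 * p - 1) * ∑ σ ∈ bridges p, (∑ k, c k * step (σ k)) ^ 2 =
      ((2 * p).choose p : ℝ) * (2 * p * ∑ k, c k ^ 2 - (∑ k, c k) ^ 2) := by
  have hs : ∀ i k : Fin (2 * p), (2 * p - 1) * ∑ σ ∈ bridges p, (step (σ i) : ℝ) * step (σ k) =
      ((2 * p).choose p : ℝ) * ((if k = i then 2 * (p : ℝ) else 0) - 1) := by
    intro i k
    by_cases h : k = i
    · subst h
      simp [step_mul_self, card_bridges]; ring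
    · rw [sum_bridges_step_mul_step (Ne.symm h), if_neg h]; ring
  calc (2 * p - 1) * ∑ σ ∈ bridges p, (∑ k, c k * (step (σ k) : ℝ)) ^ 2
      = ∑ i, ∑ k, c i * c k * ((2 * p - 1) *
          ∑ σ ∈ bridges p, (step (σ i) : ℝ) * step (σ k)) := by
        have hsq : ∀ σ : Fin (2 * p) → Bool, (∑ k, c k * (step (σ k) : ℝ)) ^ 2 =
            ∑ i, ∑ k, c i * c k * ((step (σ i) : ℝ) * step (σ k)) := by
          intro σ
          rw [sq, Finset.sum_mul_sum]
          refine Finset.sum_congr rfl fun i _ => Finset.sum_congr rfl fun k _ => ?_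
          ring
        simp only [hsq]
        rw [Finset.sum_comm, Finset.mul_sum]
        refine Finset.sum_congr rfl fun i _ => ?_
        rw [Finset.sum_comm, Finset.mul_sum]
        refine Finset.sum_congr rfl fun k _ => ?_
        rw [← Finset.mul_sum, mul_left_comm]
    _ = _ := by
        simp only [hs, mul_sub, mul_ite, mul_zero, Finset.sum_sub_distrib, Finset.sum_ite_eq',
          Finset.mem_univ, if_true]
        rw [sq (∑ k, c k), Finset.sum_mul_sum, Finset.mul_sum, Finset.mul_sum, Finset.mul_sum]
        congr 1
        · refine Finset.sum_congr rfl fun i _ => ?_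
          ring
        · refine Finset.sum_congr rfl fun i _ => ?_
          rw [Finset.mul_sum]
          refine Finset.sum_congr rfl fun k _ => ?_
          ring

theorem sum_height_telescope {m : ℕ} (σ : Fin m → Bool) (F : ℝ → ℝ) (s : ℝ) :
    ∑ i, (F (s + height σ i + step (σ i)) - F (s + height σ i)) =
      F (s + ∑ i, (step (σ i) : ℝ)) - F s := by
  induction m generalizing s with
  | zero => simp
  | succ m ih =>
    obtain ⟨b, τ, rfl⟩ : ∃ b τ, σ = (Fin.cons b τ : Fin (m + 1) → Bool) :=
      ⟨σ 0, Fin.tail σ, (Fin.cons_self_tail σ).symm⟩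
    rw [Fin.sum_univ_succ, Fin.sum_univ_succ]
    simp only [height_cons_zero, height_cons_succ, Fin.cons_zero, Fin.cons_succ, Int.cast_zero,
      add_zero, Int.cast_add]
    have := ih τ (s + step b)
    simp only [add_assoc] at this ⊢
    rw [this]
    ring

/-- The mean of the heights before and after the step `i`. -/
def meanHeight {m : ℕ} (σ : Fin m → Bool) (i : Fin m) : ℝ := height σ i + step (σ i) / 2

theorem sum_downs_midpoint {m : ℕ} (σ : Fin m → Bool) (F : ℝ → ℝ) :
    ∑ i ∈ downs σ, F (midpoint σ i) = ∑ i, (1 - step (σ i)) / 2 * F (meanHeight σ i) := by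
  rw [downs, Finset.sum_filter]
  refine Finset.sum_congr rfl fun i _ => ?_
  cases h : σ i
  · simp [h, step, midpoint, meanHeight]; ring_nf
  · simp [step]

/-- The indicator of a down-step is (1 - step)/2, and step times mean height is half the increment
of the squared height, which telescopes to zero on a closed path. -/
theorem sum_downs_midpoint_eq {p : ℕ} {σ : Fin (2 * p) → Bool} (hσ : σ ∈ bridges p) :
    ∑ i ∈ downs σ, midpoint σ i = 1 / 2 * ∑ i, meanHeight σ i := by
  have h := sum_height_telescope σ (fun x => x ^ 2) 0
  rw [sum_step_of_mem hσ] at h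
  have h' : ∑ i, (step (σ i) : ℝ) * meanHeight σ i = 0 := by
    rw [← mul_eq_zero_iff_left (two_ne_zero' ℝ), Finset.mul_sum]
    refine Eq.trans ?_ (h.trans (by ring))
    refine Finset.sum_congr rfl fun i _ => ?_
    rw [meanHeight]; ring
  rw [sum_downs_midpoint σ fun x => x, Finset.mul_sum, ← sub_eq_zero, ← Finset.sum_sub_distrib,
    ← mul_zero (-1 / 2 : ℝ), ← h', Finset.mul_sum]
  refine Finset.sum_congr rfl fun i _ => ?_
  ring

theorem sum_downs_midpoint_sq {p : ℕ} {σ : Fin (2 * p) → Bool} (hσ : σ ∈ bridges p) :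
    ∑ i ∈ downs σ, midpoint σ i ^ 2 = 1 / 2 * ∑ i, meanHeight σ i ^ 2 := by
  -- The correction -x/4 makes the increment exactly three times step times squared mean height,
  -- since the cube of a step is the step.
  have h := sum_height_telescope σ (fun x => x ^ 3 - x / 4) 0
  rw [sum_step_of_mem hσ] at h
  have h' : ∑ i, (step (σ i) : ℝ) * meanHeight σ i ^ 2 = 0 := by
    rw [← mul_eq_zero_iff_left (three_ne_zero' ℝ), Finset.mul_sum]
    refine Eq.trans ?_ (h.trans (by ring))
    refine Finset.sum_congr rfl fun i _ => ?_
    have hs := step_mul_self (σ i)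
    rw [meanHeight]
    linear_combination (-(step (σ i) : ℝ) / 4) * hs
  rw [sum_downs_midpoint σ fun x => x ^ 2, Finset.mul_sum, ← sub_eq_zero,
    ← Finset.sum_sub_distrib, ← mul_zero (-1 / 2 : ℝ), ← h', Finset.mul_sum]
  refine Finset.sum_congr rfl fun i _ => ?_
  ring

/-- The coefficient of step `k` in the mean height of step `i`. -/
def meanCoeff {m : ℕ} (i k : Fin m) : ℝ := (if k < i then 1 else 0) + if k = i then 1 / 2 else 0

theorem meanHeight_eq {m : ℕ} (σ : Fin m → Bool) (i : Fin m) :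
    meanHeight σ i = ∑ k, meanCoeff i k * step (σ k) := by
  simp only [meanHeight, height, meanCoeff, add_mul, Finset.sum_add_distrib, ite_mul, zero_mul,
    Finset.sum_ite_eq', Finset.mem_univ, if_true, one_mul]
  push_cast
  ring

theorem card_filter_fin_lt {m : ℕ} (i : Fin m) :
    (Finset.univ.filter fun k => k < i).card = i := by
  rw [← Fin.card_Iio i]; congr 1; ext; simp

theorem card_filter_fin_gt {m : ℕ} (i : Fin m) :
    (Finset.univ.filter fun k => i < k).card = m - 1 - i := by
  rw [← Fin.card_Ioi i]; congr 1; ext; simp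

theorem sum_meanCoeff {m : ℕ} (i : Fin m) : ∑ k, meanCoeff i k = i + 1 / 2 := by
  simp [meanCoeff, Finset.sum_add_distrib, card_filter_fin_lt]

theorem sum_meanCoeff_sq {m : ℕ} (i : Fin m) : ∑ k, meanCoeff i k ^ 2 = i + 1 / 4 := by
  have h : ∀ k, meanCoeff i k ^ 2 = (if k < i then 1 else 0) + if k = i then 1 / 4 else 0 := by
    intro k
    rcases lt_trichotomy k i with h | h | h
    · simp [meanCoeff, h, h.ne]
    · simp [meanCoeff, h]; norm_num
    · simp [meanCoeff, h.not_gt, h.ne']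
  simp [h, Finset.sum_add_distrib, card_filter_fin_lt]

theorem sum_meanCoeff_left {m : ℕ} (k : Fin m) : ∑ i, meanCoeff i k = m - k - 1 / 2 := by
  have h := k.2
  simp only [meanCoeff, Finset.sum_add_distrib, Finset.sum_ite_eq, Finset.mem_univ, if_true]
  rw [Finset.sum_boole, card_filter_fin_gt, Nat.cast_sub (by omega), Nat.cast_sub (by omega)]
  push_cast; ring

theorem sum_fin_quadratic (n : ℕ) (a b c : ℝ) :
    ∑ i : Fin n, (a + b * (i : ℝ) + c * (i : ℝ) ^ 2) =
      n * (a + b * (n - 1) / 2 + c * (n - 1) * (2 * n - 1) / 6) := by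
  rw [Fin.sum_univ_eq_sum_range (fun i => a + b * (i : ℝ) + c * (i : ℝ) ^ 2)]
  induction n with
  | zero => simp
  | succ n ih => rw [Finset.sum_range_succ, ih]; push_cast; ring

/-- The total of the squared midpoints of the down-steps of closed lattice paths. -/
theorem sum_bridges_sum_midpoint_sq {p : ℕ} (hp : 0 < p) :
    ∑ σ ∈ bridges p, ∑ i ∈ downs σ, midpoint σ i ^ 2 =
      ((2 * p).choose p : ℝ) * (p * (4 * p - 1) / 12) := by
  have hne : (2 * (p : ℝ) - 1) ≠ 0 := by
    have : (1 : ℝ) ≤ p := by exact_mod_cast hp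
    linarith
  apply mul_left_cancel₀ hne
  rw [Finset.sum_congr rfl fun σ hσ => sum_downs_midpoint_sq hσ, ← Finset.mul_sum,
    Finset.sum_comm, mul_left_comm, Finset.mul_sum]
  simp only [meanHeight_eq, sum_bridges_linear_sq, sum_meanCoeff, sum_meanCoeff_sq]
  rw [← Finset.mul_sum]
  have h := sum_fin_quadratic (2 * p) (2 * p * (1 / 4) - 1 / 4) (2 * p - 1) (-1)
  have e : ∑ i : Fin (2 * p), (2 * (p : ℝ) * ((i : ℝ) + 1 / 4) - ((i : ℝ) + 1 / 2) ^ 2) =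
      ∑ i : Fin (2 * p), (2 * (p : ℝ) * (1 / 4) - 1 / 4 + (2 * p - 1) * (i : ℝ) +
        (-1) * (i : ℝ) ^ 2) := Finset.sum_congr rfl fun i _ => by ring
  rw [e, h]
  push_cast
  ring

/-- The total of the squared sums of the midpoints of the down-steps of closed lattice paths. -/
theorem sum_bridges_sq_sum_midpoint {p : ℕ} (hp : 0 < p) :
    ∑ σ ∈ bridges p, (∑ i ∈ downs σ, midpoint σ i) ^ 2 =
      ((2 * p).choose p : ℝ) * (p ^ 2 * (2 * p + 1) / 12) := by
  have hne : (2 * (p : ℝ) - 1) ≠ 0 := by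
    have : (1 : ℝ) ≤ p := by exact_mod_cast hp
    linarith
  apply mul_left_cancel₀ hne
  -- The sum of all mean heights is again linear in the steps, so `sum_bridges_linear_sq` applies to
  -- it as well.
  have hlin : ∀ σ ∈ bridges p, (∑ i ∈ downs σ, midpoint σ i) ^ 2 =
      1 / 4 * (∑ k, (∑ i, meanCoeff i k) * step (σ k)) ^ 2 := by
    intro σ hσ
    rw [sum_downs_midpoint_eq hσ]
    simp only [meanHeight_eq]
    rw [Finset.sum_comm]
    simp only [Finset.sum_mul]
    ring
  rw [Finset.sum_congr rfl hlin, ← Finset.mul_sum, mul_left_comm, sum_bridges_linear_sq]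
  simp only [sum_meanCoeff_left]
  have h1 := sum_fin_quadratic (2 * p) (2 * p - 1 / 2) (-1) 0
  have h2 := sum_fin_quadratic (2 * p) ((2 * p - 1 / 2) ^ 2) (-2 * (2 * p - 1 / 2)) 1
  have e1 : ∑ k : Fin (2 * p), (((2 * p : ℕ) : ℝ) - (k : ℝ) - 1 / 2) =
      ∑ i : Fin (2 * p), (2 * (p : ℝ) - 1 / 2 + (-1) * (i : ℝ) + 0 * (i : ℝ) ^ 2) :=
    Finset.sum_congr rfl fun i _ => by push_cast; ring
  have e2 : ∑ k : Fin (2 * p), (((2 * p : ℕ) : ℝ) - (k : ℝ) - 1 / 2) ^ 2 =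
      ∑ i : Fin (2 * p), ((2 * (p : ℝ) - 1 / 2) ^ 2 + (-2 * (2 * p - 1 / 2)) * (i : ℝ) +
        1 * (i : ℝ) ^ 2) := Finset.sum_congr rfl fun i _ => by push_cast; ring
  rw [e1, e2, h1, h2]
  push_cast
  ring

/-- The steps preceding position i in reversed order are those following it in the original order,
and all steps of a closed path sum to zero. -/
theorem height_comp_rev {p : ℕ} {σ : Fin (2 * p) → Bool} (hσ : σ ∈ bridges p)
    (i : Fin (2 * p)) : height (σ ∘ Fin.revPerm) i.rev = -(height σ i + step (σ i)) := by
  have h0 := mem_bridges.1 hσ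
  have h1 : height (σ ∘ Fin.revPerm) i.rev = ∑ k, if i < k then step (σ k) else 0 := by
    rw [height, ← Equiv.sum_comp Fin.revPerm]
    simp
  have h2 : step (σ i) = ∑ k, if k = i then step (σ k) else 0 := by simp
  rw [eq_neg_iff_add_eq_zero, h1, h2, height, ← Finset.sum_add_distrib, ← Finset.sum_add_distrib]
  refine Eq.trans ?_ h0
  refine Finset.sum_congr rfl fun k _ => ?_
  rcases lt_trichotomy k i with h | h | h
  · simp [h, h.ne, h.not_gt]
  · simp [h]
  · simp [h, h.ne', h.not_gt]

/-- Reversing the order of the steps of a closed lattice path reflects the midpoints. -/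
theorem sum_bridges_prod_neg {p : ℕ} (F : ℝ → ℝ) :
    ∑ σ ∈ bridges p, ∏ i ∈ downs σ, F (midpoint σ i) =
      ∑ σ ∈ bridges p, ∏ i ∈ downs σ, F (-midpoint σ i) := by
  rw [← sum_bridges_comp_perm Fin.revPerm]
  refine Finset.sum_congr rfl fun σ hσ => ?_
  refine Finset.prod_nbij' Fin.rev Fin.rev ?_ ?_ ?_ ?_ ?_
  · intro i hi; simpa [downs] using hi
  · intro i hi; simpa [downs] using hi
  · intro i _; simp
  · intro i _; simp
  · intro i hi
    have hd : σ i.rev = false := by simpa [downs] using hi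
    have h := height_comp_rev hσ i.rev
    rw [Fin.rev_rev, hd] at h
    rw [midpoint, midpoint, h, step]
    congr 1
    push_cast
    simp
    ring

/-! ### Expansion over subsets of the down-steps. -/

/-- The sum of `d` over `D` with the elements of the subset `S` counted twice. -/
def doubledSum {ι : Type*} (d : ι → ℝ) (D S : Finset ι) : ℝ := ∑ i ∈ D, d i + ∑ i ∈ S, d i

theorem doubledSum_one {ι : Type*} (D S : Finset ι) :
    doubledSum (fun _ => 1) D S = (D.card + S.card : ℕ) := by
  simp [doubledSum]

theorem doubledSum_neg {ι : Type*} (d : ι → ℝ) (D S : Finset ι) :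
    doubledSum (fun i => -d i) D S = -doubledSum d D S := by
  simp only [doubledSum, Finset.sum_neg_distrib]; ring

/-- S is the set of factors from which the second exponential is chosen; its doubled rate explains
both D.card + S.card and `doubledSum`. -/
theorem prod_profile {ι : Type*} (θ y : ℝ) (d : ι → ℝ) (D : Finset ι) :
    ∏ i ∈ D, profile θ (y + d i) = ∑ S ∈ D.powerset, (-1) ^ S.card *
      (Real.exp (-(θ * ((D.card + S.card : ℕ) * y))) * Real.exp (-(θ * doubledSum d D S))) := by
  have hexp : ∀ S : Finset ι, ∏ i ∈ S, Real.exp (-(θ * (y + d i))) =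
      Real.exp (-(θ * (S.card * y + ∑ i ∈ S, d i))) := by
    intro S
    rw [← Real.exp_sum, Finset.sum_neg_distrib, ← Finset.mul_sum, Finset.sum_add_distrib,
      Finset.sum_const, nsmul_eq_mul]
  have hp : ∀ i, profile θ (y + d i) =
      Real.exp (-(θ * (y + d i))) * (1 + -Real.exp (-(θ * (y + d i)))) := by
    intro i
    rw [profile, mul_add _ (1 : ℝ), mul_one, mul_neg, ← Real.exp_add, sub_eq_add_neg]
    congr 3; ring
  simp only [hp, Finset.prod_mul_distrib, Finset.prod_one_add, hexp, Finset.mul_sum,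
    Finset.prod_neg]
  refine Finset.sum_congr rfl fun S _ => ?_
  rw [mul_left_comm, ← Real.exp_add, ← Real.exp_add, doubledSum]
  congr 2
  push_cast; ring

section PowersetMoments

variable {ι : Type*} [DecidableEq ι] (u : ℝ) (d : ι → ℝ)

/-- This and the next two are the derivatives of order 0, 1, 2 at t = 0 of the product over i of u
e^{t d_i} - u² e^{2 t d_i}. A single factor contributes u - u², (u - 2u²) d_i and (u - 4u²) d_i²;
powers of u - u² on the left avoid division. -/
theorem sum_powerset_weight (D : Finset ι) :
    ∑ S ∈ D.powerset, (-1) ^ S.card * u ^ (D.card + S.card) = (u - u ^ 2) ^ D.card := by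
  induction D using Finset.induction_on with
  | empty => simp
  | insert a D ha ih =>
    rw [Finset.sum_powerset_insert ha, ← Finset.sum_add_distrib, Finset.card_insert_of_notMem ha,
      pow_succ, ← ih, Finset.sum_mul]
    refine Finset.sum_congr rfl fun S hS => ?_
    rw [Finset.card_insert_of_notMem fun h => ha (Finset.mem_powerset.1 hS h)]
    ring

theorem sum_powerset_weight_mul (D : Finset ι) :
    (u - u ^ 2) * ∑ S ∈ D.powerset, (-1) ^ S.card * u ^ (D.card + S.card) * doubledSum d D S =
      (u - u ^ 2) ^ D.card * ((u - 2 * u ^ 2) * ∑ i ∈ D, d i) := by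
  induction D using Finset.induction_on with
  | empty => simp [doubledSum]
  | insert a D ha ih =>
    have key : ∑ S ∈ (insert a D).powerset, (-1) ^ S.card * u ^ ((insert a D).card + S.card) *
        doubledSum d (insert a D) S =
        (u - u ^ 2) * ∑ S ∈ D.powerset, (-1) ^ S.card * u ^ (D.card + S.card) * doubledSum d D S +
        d a * (u - 2 * u ^ 2) * ∑ S ∈ D.powerset, (-1) ^ S.card * u ^ (D.card + S.card) := by
      rw [Finset.sum_powerset_insert ha, ← Finset.sum_add_distrib, Finset.mul_sum, Finset.mul_sum,
        ← Finset.sum_add_distrib, Finset.card_insert_of_notMem ha]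
      refine Finset.sum_congr rfl fun S hS => ?_
      have haS : a ∉ S := fun h => ha (Finset.mem_powerset.1 hS h)
      rw [Finset.card_insert_of_notMem haS, doubledSum, doubledSum, doubledSum,
        Finset.sum_insert ha, Finset.sum_insert haS]
      ring
    rw [key, sum_powerset_weight, ih, Finset.card_insert_of_notMem ha, Finset.sum_insert ha]
    ring

theorem sum_powerset_weight_mul_sq (D : Finset ι) :
    (u - u ^ 2) ^ 2 *
      ∑ S ∈ D.powerset, (-1) ^ S.card * u ^ (D.card + S.card) * doubledSum d D S ^ 2 =
      (u - u ^ 2) ^ D.card * ((u - u ^ 2) * (u - 4 * u ^ 2) * ∑ i ∈ D, d i ^ 2 +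
        (u - 2 * u ^ 2) ^ 2 * ((∑ i ∈ D, d i) ^ 2 - ∑ i ∈ D, d i ^ 2)) := by
  induction D using Finset.induction_on with
  | empty => simp [doubledSum]
  | insert a D ha ih =>
    have key : ∑ S ∈ (insert a D).powerset, (-1) ^ S.card * u ^ ((insert a D).card + S.card) *
        doubledSum d (insert a D) S ^ 2 =
        (u - u ^ 2) *
          ∑ S ∈ D.powerset, (-1) ^ S.card * u ^ (D.card + S.card) * doubledSum d D S ^ 2 +
        2 * d a * (u - 2 * u ^ 2) *
          ∑ S ∈ D.powerset, (-1) ^ S.card * u ^ (D.card + S.card) * doubledSum d D S +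
        d a ^ 2 * (u - 4 * u ^ 2) * ∑ S ∈ D.powerset, (-1) ^ S.card * u ^ (D.card + S.card) := by
      rw [Finset.sum_powerset_insert ha, ← Finset.sum_add_distrib, Finset.mul_sum, Finset.mul_sum,
        Finset.mul_sum, ← Finset.sum_add_distrib, ← Finset.sum_add_distrib,
        Finset.card_insert_of_notMem ha]
      refine Finset.sum_congr rfl fun S hS => ?_
      have haS : a ∉ S := fun h => ha (Finset.mem_powerset.1 hS h)
      rw [Finset.card_insert_of_notMem haS, doubledSum, doubledSum, doubledSum,
        Finset.sum_insert ha, Finset.sum_insert haS]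
      ring
    have h1 := sum_powerset_weight_mul u d D
    rw [key, sum_powerset_weight, Finset.card_insert_of_notMem ha, Finset.sum_insert ha,
      Finset.sum_insert ha]
    linear_combination (u - u ^ 2) * ih + (u - u ^ 2) * (2 * d a * (u - 2 * u ^ 2)) * h1

end PowersetMoments

/-- The second-order term of the path expansion of the density, as a function of `u = e^{-λ}`. -/
theorem sum_bridges_second_order {p : ℕ} (hp : 0 < p) (u : ℝ) :
    (u - u ^ 2) ^ 2 * ∑ σ ∈ bridges p, ∑ S ∈ (downs σ).powerset,
      (-1) ^ S.card * u ^ (p + S.card) *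
        (doubledSum (midpoint σ) (downs σ) S ^ 2 / 2 - ((p + S.card : ℕ) : ℝ) ^ 2 / 24) =
      ((2 * p).choose p : ℝ) * (u - u ^ 2) ^ p * (p / 12) *
        ((2 * p - 1) * (u - u ^ 2) * (u - 4 * u ^ 2) + (p - 1) ^ 2 * (u - 2 * u ^ 2) ^ 2) := by
  have hterm : ∀ σ ∈ bridges p, (u - u ^ 2) ^ 2 * ∑ S ∈ (downs σ).powerset,
      (-1) ^ S.card * u ^ (p + S.card) *
        (doubledSum (midpoint σ) (downs σ) S ^ 2 / 2 - ((p + S.card : ℕ) : ℝ) ^ 2 / 24) =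
      (u - u ^ 2) ^ p * (((u - u ^ 2) * (u - 4 * u ^ 2) - (u - 2 * u ^ 2) ^ 2) / 2) *
          ∑ i ∈ downs σ, midpoint σ i ^ 2 +
        (u - u ^ 2) ^ p * ((u - 2 * u ^ 2) ^ 2 / 2) * (∑ i ∈ downs σ, midpoint σ i) ^ 2 -
        (u - u ^ 2) ^ p * ((u - u ^ 2) * (u - 4 * u ^ 2) * p +
          (u - 2 * u ^ 2) ^ 2 * (p ^ 2 - p)) / 24 := by
    intro σ hσ
    have hc := mem_bridges_iff_card.1 hσ
    have h1 := sum_powerset_weight_mul_sq u (midpoint σ) (downs σ)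
    -- With d = 1 the doubled sum is p + |S|, so the same lemma evaluates the second term.
    have h2 := sum_powerset_weight_mul_sq u (fun _ => (1 : ℝ)) (downs σ)
    simp only [doubledSum_one, hc, one_pow, Finset.sum_const, nsmul_eq_mul, mul_one] at h1 h2
    have e : ∑ S ∈ (downs σ).powerset, (-1) ^ S.card * u ^ (p + S.card) *
        (doubledSum (midpoint σ) (downs σ) S ^ 2 / 2 - ((p + S.card : ℕ) : ℝ) ^ 2 / 24) =
        (∑ S ∈ (downs σ).powerset, (-1) ^ S.card * u ^ (p + S.card) *
          doubledSum (midpoint σ) (downs σ) S ^ 2) / 2 -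
        (∑ S ∈ (downs σ).powerset, (-1) ^ S.card * u ^ (p + S.card) *
          ((p + S.card : ℕ) : ℝ) ^ 2) / 24 := by
      rw [Finset.sum_div, Finset.sum_div, ← Finset.sum_sub_distrib]
      refine Finset.sum_congr rfl fun S _ => ?_
      ring
    rw [e]
    linear_combination h1 / 2 - h2 / 24
  rw [Finset.mul_sum, Finset.sum_congr rfl hterm, Finset.sum_sub_distrib, Finset.sum_add_distrib,
    ← Finset.mul_sum, ← Finset.mul_sum, sum_bridges_sum_midpoint_sq hp,
    sum_bridges_sq_sum_midpoint hp, Finset.sum_const, nsmul_eq_mul, card_bridges]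
  ring

theorem sum_bridges_zeroth_order (p : ℕ) (u : ℝ) :
    ∑ σ ∈ bridges p, ∑ S ∈ (downs σ).powerset, (-1) ^ S.card * u ^ (p + S.card) =
      ((2 * p).choose p : ℝ) * (u - u ^ 2) ^ p := by
  have h : ∀ σ ∈ bridges p, ∑ S ∈ (downs σ).powerset, (-1) ^ S.card * u ^ (p + S.card) =
      (u - u ^ 2) ^ p := by
    intro σ hσ
    have h1 := sum_powerset_weight u (downs σ)
    rwa [mem_bridges_iff_card.1 hσ] at h1
  rw [Finset.sum_congr rfl h, Finset.sum_const, nsmul_eq_mul, card_bridges]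

/-! ### Identification of the coefficients with incomplete beta integrals. -/

/-- The incomplete beta integral `∫_0^{1-u} t^p (1-t)^{p-1} dt`. -/
def betaIntegral (p : ℕ) (u : ℝ) : ℝ := ∫ t in (0 : ℝ)..(1 - u), t ^ p * (1 - t) ^ (p - 1)

theorem hasDerivAt_betaIntegral (p : ℕ) (u : ℝ) :
    HasDerivAt (betaIntegral p) (-((1 - u) ^ p * u ^ (p - 1))) u := by
  have hc : Continuous fun t : ℝ => t ^ p * (1 - t) ^ (p - 1) := by fun_prop
  have h1 := hc.integral_hasStrictDerivAt 0 (1 - u)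
  have h2 := h1.hasDerivAt.comp u ((hasDerivAt_id u).const_sub 1)
  convert! h2 using 1
  simp

theorem betaIntegral_one (p : ℕ) : betaIntegral p 1 = 0 := by simp [betaIntegral]

theorem regIncBeta_eq {p : ℕ} (hp : 0 < p) (u : ℝ) :
    regIncBeta (1 - u) (p + 1) p = p * ((2 * p).choose p : ℝ) * betaIntegral p u := by
  obtain ⟨r, rfl⟩ := Nat.exists_eq_add_of_le' hp
  rw [regIncBeta, betaIntegral]
  have e1 : ((r + 1 : ℕ) : ℝ) + 1 + ((r + 1 : ℕ) : ℝ) = ((2 * (r + 1) : ℕ) : ℝ) + 1 := by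
    push_cast; ring
  rw [e1, Real.Gamma_nat_eq_factorial, Real.Gamma_nat_eq_factorial]
  have e2 : Real.Gamma ((r + 1 : ℕ) : ℝ) = r.factorial := by
    rw [Nat.cast_succ, Real.Gamma_nat_eq_factorial]
  have e3 := Nat.choose_mul_factorial_mul_factorial (show r + 1 ≤ 2 * (r + 1) by omega)
  rw [show 2 * (r + 1) - (r + 1) = r + 1 by omega] at e3
  have e4 : ((2 * (r + 1)).factorial : ℝ) =
      (2 * (r + 1)).choose (r + 1) * (r + 1).factorial * ((r + 1) * r.factorial) := by
    rw [← e3]; push_cast [Nat.factorial_succ r]; ring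
  have h1 : ((r + 1).factorial : ℝ) ≠ 0 := by positivity
  have h2 : (r.factorial : ℝ) ≠ 0 := by positivity
  rw [e2, e4]
  congr 1
  · push_cast; field_simp
  · congr 1; ext t
    rw [add_sub_cancel_right, Real.rpow_natCast, Nat.cast_succ, add_sub_cancel_right,
      Real.rpow_natCast, Nat.add_sub_cancel]

/-- Derivatives are compared only on the open interval: the formula of `sum_bridges_second_order`
must be divided by (x - x²)², which vanishes at 1. -/
theorem eq_of_hasDerivAt_eq_of_eq_one {f g f' : ℝ → ℝ} {u : ℝ} (hu0 : 0 < u) (hu1 : u ≤ 1)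
    (hf : ∀ x, 0 < x → x ≤ 1 → ContinuousAt f x) (hg : ∀ x, 0 < x → x ≤ 1 → ContinuousAt g x)
    (hf' : ∀ x, 0 < x → x < 1 → HasDerivAt f (f' x) x)
    (hg' : ∀ x, 0 < x → x < 1 → HasDerivAt g (f' x) x) (h1 : f 1 = g 1) : f u = g u := by
  have hfc : ContinuousOn f (Set.Icc u 1) := fun x hx =>
    (hf x (hu0.trans_le hx.1) hx.2).continuousWithinAt
  have hgc : ContinuousOn g (Set.Icc u 1) := fun x hx =>
    (hg x (hu0.trans_le hx.1) hx.2).continuousWithinAt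
  have h := constant_of_has_deriv_right_zero (hfc.sub hgc) (fun x hx => by
    have hx0 := hu0.trans_le hx.1
    simpa using ((hf' x hx0 hx.2).sub (hg' x hx0 hx.2)).hasDerivWithinAt) 1 ⟨hu1, le_rfl⟩
  simp only [Pi.sub_apply, h1, sub_self] at h
  linarith

theorem hasDerivAt_one_sub_pow_mul {A : ℕ} (hA : 0 < A) (c u : ℝ) (hu : u ≠ 0) :
    HasDerivAt (fun x : ℝ => (1 - x ^ A) * c) (-(u ^ A * (A * c)) / u) u := by
  have h := ((hasDerivAt_pow A u).const_sub 1).mul_const c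
  convert! h using 1
  obtain ⟨r, rfl⟩ := Nat.exists_eq_add_of_le' hA
  rw [Nat.add_sub_cancel, pow_succ]
  field_simp

/-- Differentiation produces the factor p + |S|, which cancels the denominators in the path sums and
reduces them to the subset moments. -/
theorem hasDerivAt_path_sum {p : ℕ} (hp : 0 < p)
    (c : (Fin (2 * p) → Bool) → Finset (Fin (2 * p)) → ℝ) {u : ℝ} (hu : u ≠ 0) :
    HasDerivAt (fun x : ℝ => ∑ σ ∈ bridges p, ∑ S ∈ (downs σ).powerset,
        (-1) ^ S.card * ((1 - x ^ (p + S.card)) * c σ S))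
      (-(∑ σ ∈ bridges p, ∑ S ∈ (downs σ).powerset, (-1) ^ S.card * u ^ (p + S.card) *
        ((p + S.card : ℕ) * c σ S)) / u) u := by
  have h : HasDerivAt (fun x : ℝ => ∑ σ ∈ bridges p, ∑ S ∈ (downs σ).powerset,
        (-1) ^ S.card * ((1 - x ^ (p + S.card)) * c σ S))
      (∑ σ ∈ bridges p, ∑ S ∈ (downs σ).powerset, (-1) ^ S.card *
        (-(u ^ (p + S.card) * ((p + S.card : ℕ) * c σ S)) / u)) u :=
    HasDerivAt.fun_sum fun σ _ => HasDerivAt.fun_sum fun S _ =>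
      (hasDerivAt_one_sub_pow_mul (by omega) _ u hu).const_mul _
  convert! h using 1
  rw [neg_div, Finset.sum_div, ← Finset.sum_neg_distrib]
  refine Finset.sum_congr rfl fun σ _ => ?_
  rw [Finset.sum_div, ← Finset.sum_neg_distrib]
  refine Finset.sum_congr rfl fun S _ => ?_
  ring

/-- Both sides vanish at u = 1 and have derivative -C(2p,p) u^(p-1) (1-u)^p. -/
theorem path_sum_leading {p : ℕ} (hp : 0 < p) {u : ℝ} (hu0 : 0 < u) (hu1 : u ≤ 1) :
    ∑ σ ∈ bridges p, ∑ S ∈ (downs σ).powerset,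
      (-1) ^ S.card * ((1 - u ^ (p + S.card)) * (1 / (p + S.card : ℕ))) =
    ((2 * p).choose p : ℝ) * betaIntegral p u := by
  have hd := fun x (hx : 0 < x) => hasDerivAt_path_sum hp
    (fun (_ : Fin (2 * p) → Bool) S => 1 / ((p + S.card : ℕ) : ℝ)) (u := x) hx.ne'
  have hb := fun x => (hasDerivAt_betaIntegral p x).const_mul ((2 * p).choose p : ℝ)
  refine eq_of_hasDerivAt_eq_of_eq_one (f := fun u => ∑ σ ∈ bridges p, ∑ S ∈ (downs σ).powerset,
      (-1) ^ S.card * ((1 - u ^ (p + S.card)) * (1 / (p + S.card : ℕ))))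
    (g := fun u => ((2 * p).choose p : ℝ) * betaIntegral p u) hu0 hu1
    (fun x hx _ => (hd x hx).continuousAt) (fun x _ _ => (hb x).continuousAt)
    (fun x hx _ => hd x hx) (fun x hx _ => ?_) (by simp [betaIntegral_one])
  convert! hb x using 1
  have e : ∑ σ ∈ bridges p, ∑ S ∈ (downs σ).powerset, (-1) ^ S.card * x ^ (p + S.card) *
      (((p + S.card : ℕ) : ℝ) * (1 / ((p + S.card : ℕ) : ℝ))) =
      ((2 * p).choose p : ℝ) * (x - x ^ 2) ^ p := by
    rw [← sum_bridges_zeroth_order]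
    refine Finset.sum_congr rfl fun σ _ => Finset.sum_congr rfl fun S _ => ?_
    have : ((p + S.card : ℕ) : ℝ) ≠ 0 := by positivity
    rw [mul_one_div_cancel this, mul_one]
  rw [e]
  obtain ⟨r, rfl⟩ := Nat.exists_eq_add_of_le' hp
  rw [Nat.add_sub_cancel, show x - x ^ 2 = x * (1 - x) by ring, mul_pow, pow_succ x]
  field_simp

theorem path_sum_correction {p : ℕ} (hp : 0 < p) {u : ℝ} (hu0 : 0 < u) (hu1 : u ≤ 1) :
    ∑ σ ∈ bridges p, ∑ S ∈ (downs σ).powerset,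
      (-1) ^ S.card * ((1 - u ^ (p + S.card)) *
        (doubledSum (midpoint σ) (downs σ) S ^ 2 / (2 * (p + S.card : ℕ)) -
          ((p + S.card : ℕ) : ℝ) / 24)) =
    -(p * ((2 * p).choose p : ℝ) / 12) * (2 * p * betaIntegral p u +
      u ^ p * (1 - u) ^ (p - 1) * (2 + p - (2 * p + 1) * u)) := by
  have hd := fun x (hx : 0 < x) => hasDerivAt_path_sum hp
    (fun σ S => doubledSum (midpoint σ) (downs σ) S ^ 2 / (2 * (p + S.card : ℕ)) -
          ((p + S.card : ℕ) : ℝ) / 24) (u := x) hx.ne'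
  have hb := fun x : ℝ => (((hasDerivAt_betaIntegral p x).const_mul (2 * p : ℝ)).add
    (((hasDerivAt_pow p x).mul (((hasDerivAt_id x).const_sub 1).pow (p - 1))).mul
      (((hasDerivAt_id x).const_mul (2 * p + 1 : ℝ)).const_sub (2 + p : ℝ)))).const_mul
        (-(p * ((2 * p).choose p : ℝ) / 12))
  refine eq_of_hasDerivAt_eq_of_eq_one
    (f := fun u => ∑ σ ∈ bridges p, ∑ S ∈ (downs σ).powerset,
      (-1) ^ S.card * ((1 - u ^ (p + S.card)) *
        (doubledSum (midpoint σ) (downs σ) S ^ 2 / (2 * (p + S.card : ℕ)) -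
          ((p + S.card : ℕ) : ℝ) / 24)))
    (g := fun u => -(p * ((2 * p).choose p : ℝ) / 12) * (2 * p * betaIntegral p u +
      u ^ p * (1 - u) ^ (p - 1) * (2 + p - (2 * p + 1) * u))) hu0 hu1
    (fun x hx _ => (hd x hx).continuousAt) (fun x _ _ => (hb x).continuousAt)
    (fun x hx _ => hd x hx) (fun x hx hx1 => ?_) ?_
  · convert! hb x using 1
    have e : ∑ σ ∈ bridges p, ∑ S ∈ (downs σ).powerset, (-1) ^ S.card * x ^ (p + S.card) *
        (((p + S.card : ℕ) : ℝ) * (doubledSum (midpoint σ) (downs σ) S ^ 2 /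
          (2 * (p + S.card : ℕ)) - ((p + S.card : ℕ) : ℝ) / 24)) =
        ∑ σ ∈ bridges p, ∑ S ∈ (downs σ).powerset, (-1) ^ S.card * x ^ (p + S.card) *
          (doubledSum (midpoint σ) (downs σ) S ^ 2 / 2 - ((p + S.card : ℕ) : ℝ) ^ 2 / 24) := by
      refine Finset.sum_congr rfl fun σ _ => Finset.sum_congr rfl fun S _ => ?_
      have : ((p + S.card : ℕ) : ℝ) ≠ 0 := by positivity
      congr 1
      field_simp
    rw [e]
    have h2 := sum_bridges_second_order hp x
    generalize ∑ σ ∈ bridges p, ∑ S ∈ (downs σ).powerset, (-1) ^ S.card * x ^ (p + S.card) *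
          (doubledSum (midpoint σ) (downs σ) S ^ 2 / 2 - ((p + S.card : ℕ) : ℝ) ^ 2 / 24) = R at h2
    have hv : 1 - x ≠ 0 := by linarith
    have hf : x - x ^ 2 ≠ 0 := by
      rw [show x - x ^ 2 = x * (1 - x) by ring]; positivity
    generalize ((2 * p).choose p : ℝ) = C at h2
    rw [div_eq_iff hx.ne']
    apply mul_left_cancel₀ (pow_ne_zero 2 hf)
    rw [mul_neg, h2]
    obtain ⟨r, rfl⟩ := Nat.exists_eq_add_of_le' hp
    simp only [Nat.add_sub_cancel, id, Pi.mul_apply, Pi.pow_apply]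
    -- Differentiating (1-x)^r leaves the exponent r - 1, truncated at r = 0; the factor r makes
    -- this harmless.
    have hX : (r : ℝ) * (1 - x) ^ (r - 1) * (1 - x) = r * (1 - x) ^ r := by
      cases r with
      | zero => simp
      | succ r => rw [Nat.add_sub_cancel, pow_succ]; ring
    generalize (r : ℝ) * (1 - x) ^ (r - 1) = X at hX
    have hpow : (x - x ^ 2) ^ (r + 1) = x ^ r * x * ((1 - x) ^ r * (1 - x)) := by
      rw [← pow_succ, ← pow_succ, ← mul_pow]; congr 1; ring
    rw [hpow, pow_succ x, pow_succ (1 - x)]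
    push_cast
    linear_combination (-(x ^ 2 * (1 - x) * (r + 1) * C / 12 * x ^ (r + 2) *
      (3 + r - (2 * r + 3) * x))) * hX
  -- At u = 1 and p = 1 the power (1-u)^(p-1) is 1, and it is the last factor 2 + p - (2p+1)u that
  -- vanishes; for larger p the power itself does.
  · obtain ⟨r, rfl⟩ := Nat.exists_eq_add_of_le' hp
    cases r with
    | zero => simp [betaIntegral_one]
    | succ r => simp [betaIntegral_one]

/-! ### Asymptotics of one term. -/

theorem cosh_sub_isBigO :
    (fun x : ℝ => Real.cosh x - (1 + x ^ 2 / 2)) =O[nhds 0] fun x => x ^ 4 := by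
  have h := Real.exp_sub_sum_range_isBigO_pow 4
  have hneg := h.comp_tendsto (show Tendsto (fun x : ℝ => -x) (nhds 0) (nhds 0) by
    simpa using (continuous_neg.tendsto (0 : ℝ)))
  have hneg' : (fun x : ℝ => Real.exp (-x) - ∑ i ∈ Finset.range 4, (-x) ^ i / i.factorial)
      =O[nhds 0] fun x => x ^ 4 :=
    hneg.congr_right fun x => by simp [Even.neg_pow (show Even 4 by decide)]
  refine ((h.add hneg').const_mul_left (1 / 2)).congr_left fun x => ?_
  simp [Real.cosh_eq, Finset.sum_range_succ, Nat.factorial]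
  ring

theorem sinh_sub_isBigO :
    (fun x : ℝ => Real.sinh x - (x + x ^ 3 / 6)) =O[nhds 0] fun x => x ^ 5 := by
  have h := Real.exp_sub_sum_range_isBigO_pow 5
  have hneg := h.comp_tendsto (show Tendsto (fun x : ℝ => -x) (nhds 0) (nhds 0) by
    simpa using (continuous_neg.tendsto (0 : ℝ)))
  have hneg' : (fun x : ℝ => Real.exp (-x) - ∑ i ∈ Finset.range 5, (-x) ^ i / i.factorial)
      =O[nhds 0] fun x => x ^ 5 :=
    hneg.trans ((isBigO_refl (fun x : ℝ => x ^ 5) _).neg_left.congr_left fun x => by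
      simp [Odd.neg_pow (show Odd 5 by decide)])
  refine ((h.sub hneg').const_mul_left (1 / 2)).congr_left fun x => ?_
  simp [Real.sinh_eq, Finset.sum_range_succ, Nat.factorial]
  ring

theorem cosh_div_sinh_isBigO (w : ℝ) :
    (fun z : ℝ => Real.cosh (w * z) / Real.sinh z - (1 / z + z * (w ^ 2 / 2 - 1 / 6)))
      =O[nhdsWithin 0 (Set.Ioi 0)] fun z => z ^ 3 := by
  set c := w ^ 2 / 2 - 1 / 6 with hc
  -- The numerator over the common denominator z sinh z. The value of c cancels its z³ term, and
  -- sinh z ≥ z bounds the denominator below by z².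
  have hg : (fun z : ℝ => Real.cosh (w * z) * z - Real.sinh z * (1 + c * z ^ 2))
      =O[nhds 0] fun z => z ^ 5 := by
    have h1 : (fun z : ℝ => z * (Real.cosh (w * z) - (1 + (w * z) ^ 2 / 2)))
        =O[nhds 0] fun z => z ^ 5 := by
      have h := cosh_sub_isBigO.comp_tendsto (show Tendsto (fun z : ℝ => w * z) (nhds 0) (nhds 0) by
        simpa using ((continuous_const_mul w).tendsto (0 : ℝ)))
      have h' : (fun z : ℝ => Real.cosh (w * z) - (1 + (w * z) ^ 2 / 2)) =O[nhds 0]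
          fun z => z ^ 4 := by
        refine h.trans ?_
        simp only [Function.comp_def, mul_pow]
        exact (isBigO_refl _ _).const_mul_left _
      exact ((isBigO_refl (fun z : ℝ => z) _).mul h').congr_right fun z => by ring
    have h2 : (fun z : ℝ => (Real.sinh z - (z + z ^ 3 / 6)) * (1 + c * z ^ 2))
        =O[nhds 0] fun z => z ^ 5 := by
      have hb : (fun z : ℝ => 1 + c * z ^ 2) =O[nhds 0] fun _ => (1 : ℝ) :=
        (show Continuous fun z : ℝ => 1 + c * z ^ 2 by fun_prop).continuousAt.isBigO_one ℝ
      simpa using sinh_sub_isBigO.mul hb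
    have h3 : (fun z : ℝ => -(c / 6) * z ^ 5) =O[nhds 0] fun z => z ^ 5 :=
      (isBigO_refl _ _).const_mul_left _
    refine ((h1.sub h2).add h3).congr_left fun z => ?_
    rw [hc]; ring
  obtain ⟨K, hKnn, hK⟩ := hg.exists_nonneg
  rw [IsBigOWith_def] at hK
  refine IsBigO.of_bound K ?_
  filter_upwards [nhdsWithin_le_nhds hK, self_mem_nhdsWithin] with z hz hz0
  have hz0 : 0 < z := hz0
  have hs : z ≤ Real.sinh z := Real.self_le_sinh_iff.2 hz0.le
  have hs0 : 0 < Real.sinh z := hz0.trans_le hs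
  have e : Real.cosh (w * z) / Real.sinh z - (1 / z + z * c) =
      (Real.cosh (w * z) * z - Real.sinh z * (1 + c * z ^ 2)) / (z * Real.sinh z) := by
    field_simp
  rw [e, norm_div, Real.norm_of_nonneg (by positivity : 0 ≤ z * Real.sinh z),
    div_le_iff₀ (by positivity)]
  refine hz.trans ?_
  rw [norm_pow, norm_pow, Real.norm_of_nonneg hz0.le]
  calc K * z ^ 5 = K * z ^ 3 * (z * z) := by ring
    _ ≤ K * z ^ 3 * (z * Real.sinh z) := by gcongr

/-- Sampling at half-integers makes each term times 2 sinh z a difference of exponentials at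
consecutive integers. -/
theorem sum_exp_mul_sinh (z : ℝ) (N : ℕ) :
    (∑ j ∈ Finset.range N, Real.exp (-(2 * z * (j + 1 / 2)))) * (2 * Real.sinh z) =
      1 - Real.exp (-(2 * z * N)) := by
  induction N with
  | zero => simp
  | succ N ih =>
    rw [Finset.sum_range_succ, add_mul, ih, Real.sinh_eq]
    have e : Real.exp (-(2 * z * (N + 1 / 2))) * (2 * ((Real.exp z - Real.exp (-z)) / 2)) =
        Real.exp (-(2 * z * N)) - Real.exp (-(2 * z * (N + 1 : ℕ))) := by
      rw [mul_div_cancel₀ _ (two_ne_zero' ℝ), mul_sub, ← Real.exp_add, ← Real.exp_add]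
      congr 2 <;> push_cast <;> ring
    rw [e]; ring

/-- With z = λA/(2N) and w = 2D/A the product is exactly (1 - e^{-λA}) cosh(wz)/(2 sinh z): for
fixed λ, N enters only through z. -/
theorem sum_exp_mul_cosh_isBigO {lam : ℝ} (hlam : 0 < lam) {A : ℕ} (hA : 0 < A) (D : ℝ) :
    (fun N : ℕ => (∑ j ∈ Finset.range N, Real.exp (-(lam / N * (A * (j + 1 / 2))))) *
        Real.cosh (lam / N * D) -
      (1 - Real.exp (-lam) ^ A) * (1 / (lam * A) * N + lam * (D ^ 2 / (2 * A) - A / 24) / N))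
      =O[atTop] fun N : ℕ => 1 / (N : ℝ) ^ 3 := by
  have hA' : (0 : ℝ) < A := by exact_mod_cast hA
  have hlim : Tendsto (fun N : ℕ => lam * A / 2 / (N : ℝ)) atTop (nhdsWithin 0 (Set.Ioi 0)) := by
    refine tendsto_nhdsWithin_iff.2 ⟨tendsto_const_div_atTop_nhds_zero_nat _, ?_⟩
    filter_upwards [eventually_gt_atTop 0] with N hN
    have : (0 : ℝ) < N := by exact_mod_cast hN
    exact Set.mem_Ioi.2 (by positivity)
  have h := ((cosh_div_sinh_isBigO (2 * D / A)).comp_tendsto hlim).const_mul_left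
    ((1 - Real.exp (-lam) ^ A) / 2)
  have hright : ((fun z : ℝ => z ^ 3) ∘ fun N : ℕ => lam * A / 2 / (N : ℝ)) =O[atTop]
      fun N : ℕ => 1 / (N : ℝ) ^ 3 := by
    refine ((isBigO_refl (fun N : ℕ => 1 / (N : ℝ) ^ 3) atTop).const_mul_left
      ((lam * A / 2) ^ 3)).congr_left fun N => ?_
    simp only [Function.comp_apply]; ring
  refine (h.trans hright).congr' ?_ EventuallyEq.rfl
  filter_upwards [eventually_gt_atTop 0] with N hN
  have hN' : (0 : ℝ) < N := by exact_mod_cast hN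
  simp only [Function.comp_apply]
  set z := lam * A / 2 / (N : ℝ) with hz
  have hz0 : 0 < z := by positivity
  have hs0 : 0 < Real.sinh z := Real.sinh_pos_iff.2 hz0
  have hsum := sum_exp_mul_sinh z N
  have e1 : Real.exp (-(2 * z * N)) = Real.exp (-lam) ^ A := by
    rw [← Real.exp_nat_mul]; congr 1; rw [hz]; field_simp
  have e2 : ∀ j : ℕ, Real.exp (-(lam / N * (A * (j + 1 / 2)))) =
      Real.exp (-(2 * z * (j + 1 / 2))) := by
    intro j; congr 1; rw [hz]; ring
  have e3 : lam / N * D = 2 * D / A * z := by rw [hz]; field_simp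
  have e4 : 1 / (lam * A) * N + lam * (D ^ 2 / (2 * A) - A / 24) / N =
      (1 / z + z * ((2 * D / A) ^ 2 / 2 - 1 / 6)) / 2 := by
    rw [hz]; field_simp; ring
  simp only [e2]
  rw [e3, e4, ← e1, ← hsum]
  field_simp

/-! ### Exact formula for the moment and matching of the coefficients. -/

theorem pow_mul_moment_eq_sum_cosh {θ : ℝ} (hθ : 0 < θ) (N p : ℕ) :
    Real.exp (-θ) ^ p * moment N p (Real.exp (-θ)) =
      ∑ σ ∈ bridges p, ∑ S ∈ (downs σ).powerset, (-1) ^ S.card *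
        ((∑ j ∈ Finset.range N, Real.exp (-(θ * ((p + S.card : ℕ) * (j + 1 / 2))))) *
          Real.cosh (θ * doubledSum (midpoint σ) (downs σ) S)) := by
  have hsym : ∀ j : ℕ, ∑ σ ∈ bridges p, ∏ i ∈ downs σ, profile θ (j + 1 / 2 + midpoint σ i) =
      ∑ σ ∈ bridges p, ∑ S ∈ (downs σ).powerset, (-1) ^ S.card *
        (Real.exp (-(θ * ((p + S.card : ℕ) * (j + 1 / 2)))) *
          Real.cosh (θ * doubledSum (midpoint σ) (downs σ) S)) := by
    intro j
    have h := sum_bridges_prod_neg (p := p) fun d => profile θ (j + 1 / 2 + d)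
    rw [← add_halves (∑ σ ∈ bridges p, ∏ i ∈ downs σ, profile θ (j + 1 / 2 + midpoint σ i))]
    -- One half of the sum is replaced by its reflection, so that the exponentials of ± the same
    -- argument pair into a cosh.
    nth_rewrite 2 [h]
    rw [← add_div, ← Finset.sum_add_distrib, Finset.sum_div]
    refine Finset.sum_congr rfl fun σ hσ => ?_
    rw [prod_profile, prod_profile θ _ (fun i => -midpoint σ i), ← Finset.sum_add_distrib,
      Finset.sum_div]
    refine Finset.sum_congr rfl fun S _ => ?_
    rw [mem_bridges_iff_card.1 hσ, doubledSum_neg, Real.cosh_eq, mul_neg, neg_neg]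
    ring
  rw [pow_mul_moment_eq hθ, Finset.sum_congr rfl fun j _ => hsym j, Finset.sum_comm]
  refine Finset.sum_congr rfl fun σ _ => ?_
  rw [Finset.sum_comm]
  refine Finset.sum_congr rfl fun S _ => ?_
  rw [Finset.sum_mul, Finset.mul_sum]

theorem genusZeroCoeff_eq {p : ℕ} (hp : 0 < p) {lam : ℝ} (hlam : 0 < lam) :
    genusZeroCoeff p lam = ∑ σ ∈ bridges p, ∑ S ∈ (downs σ).powerset,
      (-1) ^ S.card * ((1 - Real.exp (-lam) ^ (p + S.card)) * (1 / (lam * (p + S.card : ℕ)))) := by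
  have h := path_sum_leading hp (Real.exp_pos (-lam)) (Real.exp_le_one_iff.2 (by linarith))
  have hp' : (p : ℝ) ≠ 0 := by positivity
  rw [genusZeroCoeff, regIncBeta_eq hp, show 1 / (lam * p) * (p * ((2 * p).choose p : ℝ) *
    betaIntegral p (Real.exp (-lam))) = 1 / lam * (((2 * p).choose p : ℝ) *
    betaIntegral p (Real.exp (-lam))) by field_simp, ← h, Finset.mul_sum]
  refine Finset.sum_congr rfl fun σ _ => ?_
  rw [Finset.mul_sum]
  refine Finset.sum_congr rfl fun S _ => ?_
  rw [one_div_mul_eq_div, ← one_div_mul_one_div]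
  ring

theorem choose_eq_two_mul_factorial_div {p : ℕ} (hp : 0 < p) : ((2 * p).choose p : ℝ) =
    2 * (((2 * p - 1).factorial : ℝ) / ((p.factorial : ℝ) * ((p - 1).factorial : ℝ))) := by
  obtain ⟨r, rfl⟩ := Nat.exists_eq_add_of_le' hp
  have e3 := Nat.choose_mul_factorial_mul_factorial (show r + 1 ≤ 2 * (r + 1) by omega)
  rw [show 2 * (r + 1) - (r + 1) = r + 1 by omega, show 2 * (r + 1) = 2 * r + 1 + 1 by ring,
    Nat.factorial_succ (2 * r + 1), Nat.factorial_succ r] at e3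
  rw [show 2 * (r + 1) - 1 = 2 * r + 1 by omega, show 2 * (r + 1) = 2 * r + 1 + 1 by ring,
    Nat.add_sub_cancel, Nat.factorial_succ r]
  have e4 : ((2 * r + 1 + 1).choose (r + 1) : ℝ) * ((r + 1) * r.factorial) *
      ((r + 1) * r.factorial) = (2 * r + 1 + 1) * (2 * r + 1).factorial := by exact_mod_cast e3
  have h2 : (r.factorial : ℝ) ≠ 0 := by positivity
  have h3 : (r : ℝ) + 1 ≠ 0 := by positivity
  push_cast
  rw [← mul_div_assoc, eq_div_iff (by positivity)]
  apply mul_left_cancel₀ h3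
  linear_combination e4

theorem genusOneCoeff_eq {p : ℕ} (hp : 0 < p) {lam : ℝ} (hlam : 0 < lam) :
    genusOneCoeff p lam = ∑ σ ∈ bridges p, ∑ S ∈ (downs σ).powerset,
      (-1) ^ S.card * ((1 - Real.exp (-lam) ^ (p + S.card)) *
        (lam * (doubledSum (midpoint σ) (downs σ) S ^ 2 / (2 * (p + S.card : ℕ)) -
          ((p + S.card : ℕ) : ℝ) / 24))) := by
  have h := path_sum_correction hp (Real.exp_pos (-lam)) (Real.exp_le_one_iff.2 (by linarith))
  have hc := choose_eq_two_mul_factorial_div hp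
  have hexp : Real.exp (-(p * lam)) = Real.exp (-lam) ^ p := by
    rw [← Real.exp_nat_mul]; congr 1; ring
  have e : genusOneCoeff p lam = lam * (-(p * ((2 * p).choose p : ℝ) / 12) *
      (2 * p * betaIntegral p (Real.exp (-lam)) + Real.exp (-lam) ^ p *
        (1 - Real.exp (-lam)) ^ (p - 1) * (2 + p - (2 * p + 1) * Real.exp (-lam)))) := by
    rw [genusOneCoeff, regIncBeta_eq hp, hexp, hc]
    ring
  rw [e, ← h, Finset.mul_sum]
  refine Finset.sum_congr rfl fun σ _ => ?_
  rw [Finset.mul_sum]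
  refine Finset.sum_congr rfl fun S _ => ?_
  ring

end DiscreteQGUE

end

theorem theorem2p2 (lam : ℝ) (hlam : 0 < lam) (p : ℕ) (hp : 0 < p) :
    (∀ N : ℕ, 0 < N →
      DiscreteQGUE.JacksonIntegrable (DiscreteQGUE.scaledQ lam N) (-1) 1
          (fun x => |x| ^ (2 * p) *
            DiscreteQGUE.density N (DiscreteQGUE.scaledQ lam N) x) ∧
        DiscreteQGUE.JacksonIntegrable (DiscreteQGUE.scaledQ lam N)
          (-1 / √(1 - DiscreteQGUE.scaledQ lam N)) (1 / √(1 - DiscreteQGUE.scaledQ lam N))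
          (fun x => |x| ^ (2 * p) *
            DiscreteQGUE.densityHat N (DiscreteQGUE.scaledQ lam N) x) ∧
        DiscreteQGUE.scaledQ lam N ^ p *
            DiscreteQGUE.moment N p (DiscreteQGUE.scaledQ lam N) =
          (DiscreteQGUE.scaledQ lam N * (1 - DiscreteQGUE.scaledQ lam N)) ^ p *
            DiscreteQGUE.momentHat N p (DiscreteQGUE.scaledQ lam N)) ∧
    (fun N : ℕ =>
        DiscreteQGUE.scaledQ lam N ^ p *
            DiscreteQGUE.moment N p (DiscreteQGUE.scaledQ lam N) -
          (DiscreteQGUE.genusZeroCoeff p lam * (N : ℝ) +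
            DiscreteQGUE.genusOneCoeff p lam / (N : ℝ)))
      =O[atTop] fun N : ℕ => 1 / (N : ℝ) ^ 3 := by
  have hθ : ∀ N : ℕ, 0 < N → 0 < lam / N := fun N hN => by positivity
  have hQ : ∀ N : ℕ, DiscreteQGUE.scaledQ lam N = Real.exp (-(lam / N)) := fun N => by
    rw [DiscreteQGUE.scaledQ, neg_div]
  refine ⟨fun N hN => ?_, ?_⟩
  · have hq0 : 0 < DiscreteQGUE.scaledQ lam N := Real.exp_pos _
    have hq1 : DiscreteQGUE.scaledQ lam N < 1 := by
      rw [hQ]; exact Real.exp_lt_one_iff.2 (neg_lt_zero.2 (hθ N hN))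
    refine ⟨DiscreteQGUE.jacksonIntegrable_moment hq0 hq1 N p,
      DiscreteQGUE.jacksonIntegrable_momentHat hq0 hq1 N p, ?_⟩
    have hne : 1 - DiscreteQGUE.scaledQ lam N ≠ 0 := by linarith
    rw [DiscreteQGUE.momentHat_eq hq1, mul_pow]
    field_simp
  · have hterm := fun (σ : Fin (2 * p) → Bool) (S : Finset (Fin (2 * p))) =>
      (DiscreteQGUE.sum_exp_mul_cosh_isBigO hlam (A := p + S.card) (by omega)
        (DiscreteQGUE.doubledSum (DiscreteQGUE.midpoint σ) (DiscreteQGUE.downs σ) S)).const_mul_left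
          ((-1) ^ S.card)
    -- Paths and subsets depend on p alone, so finitely many error terms are added, their number
    -- independent of N.
    have hsum := IsBigO.sum (s := DiscreteQGUE.bridges p) fun σ _ =>
      IsBigO.sum (s := (DiscreteQGUE.downs σ).powerset) fun S _ => hterm σ S
    refine hsum.congr' ?_ EventuallyEq.rfl
    filter_upwards [eventually_gt_atTop 0] with N hN
    have h0 := congrArg (· * (N : ℝ)) (DiscreteQGUE.genusZeroCoeff_eq hp hlam)
    have h1 := congrArg (· / (N : ℝ)) (DiscreteQGUE.genusOneCoeff_eq hp hlam)
    simp only [Finset.sum_mul, Finset.sum_div] at h0 h1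
    rw [hQ, DiscreteQGUE.pow_mul_moment_eq_sum_cosh (hθ N hN), h0, h1,
      ← Finset.sum_add_distrib, ← Finset.sum_sub_distrib]
    simp only [Finset.sum_apply]
    refine Finset.sum_congr rfl fun σ _ => ?_
    rw [← Finset.sum_add_distrib, ← Finset.sum_sub_distrib]
    refine Finset.sum_congr rfl fun S _ => ?_
    ring
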